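/- Let $d\ge 2$. Consider Bernoulli bond percolation on $\mathbb Z^d$ with parameter $p$: each (unoriented) nearest-neighbour edge is open with probability $p$ and closed with probability $1-p$, independently; let $Q=Q_p$ be the law of the configuration $\omega$. For an integer $n\ge 1$ let $\mathcal C^n$ be the set of points of $\mathbb Z^d$ that can be reached from the origin by an open path contained in $[-n,n]^d$. For $A\subset\mathcal C^n$ let $\partial_{\mathcal C^n}A$ be the set of open edges with both end points in $\mathcal C^n$, exactly one of them in $A$, and let $$I_\infty(\mathcal C^n)=\inf\Big\{\frac{\#\partial_{\mathcal C^n}A}{\#A}\;:\;\emptyset\ne A\subset\mathcal C^n,\ \#A\le\tfrac12\#\mathcal C^n\Big\}$$ be the Cheeger constant of $\mathcal C^n$ ($\inf\emptyset=+\infty$). Let $\lambda^n$ be the lowest non-zero eigenvalue of the discrete Laplacian on $\mathcal C^n$, $$(Lf)(x)=\frac1{2d}\sum_{y\in\mathcal C^n,\ \{x,y\}\text{ an open edge}}(f(x)-f(y)),\qquad f:\mathcal C^n\to\mathbb R,$$ with $\lambda^n=+\infty$ if $\mathcal C^n$ is a single point. Theorem. For each $d\ge2$ there are $p(d)<1$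 and constants $\beta,\xi>0$, depending only on $d$, such that for all $p\in(p(d),1)$ and all integers $n\ge1$ $$Q\Big[I_\infty(\mathcal C^n)\le\frac{\beta}{n}\Big]\le \exp\big(-\xi\,n^{(d-1)/d}\big)\qquad\text{and}\qquad Q\Big[\lambda^n\le\frac{\beta}{n^2}\Big]\le \exp\big(-\xi\,n^{(d-1)/d}\big).$$ -/

import Mathlib

namespace Percolation

open MeasureTheory ProbabilityTheory unitInterval

/-- The nearest-neighbour graph on `ℤ^d`: `x ∼ y` iff their `ℓ¹` distance is `1`. -/
def latticeGraph (d : ℕ) : SimpleGraph (Fin d → ℤ) where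
  Adj x y := ∑ i, |x i - y i| = 1
  symm := ⟨fun x y h => by simpa only [abs_sub_comm] using h⟩
  loopless := ⟨fun x h => by simp at h⟩

/-- A bond configuration: every (unoriented) edge of `ℤ^d` is open (`true`) or closed (`false`). -/
abbrev Config (d : ℕ) : Type := (latticeGraph d).edgeSet → Bool

/-- The law `Q` of Bernoulli bond percolation: the edges are independently open with
probability `p` and closed with probability `1 - p`. -/
noncomputable def bondMeasure (d : ℕ) (p : I) : Measure (Config d) :=
  Measure.infinitePi fun _ => bernoulliMeasure true false p

/-- The random subgraph of `ℤ^d` formed by the open edges. -/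
def openGraph {d : ℕ} (ω : Config d) : SimpleGraph (Fin d → ℤ) where
  Adj x y := ∃ h : (latticeGraph d).Adj x y, ω ⟨s(x, y), h⟩ = true
  symm := ⟨fun x y ⟨h, hω⟩ => by
    have e : (⟨s(y, x), h.symm⟩ : (latticeGraph d).edgeSet) = ⟨s(x, y), h⟩ :=
      Subtype.ext Sym2.eq_swap
    exact ⟨h.symm, by rw [e]; exact hω⟩⟩
  loopless := ⟨fun x ⟨h, _⟩ => (latticeGraph d).loopless.irrefl x h⟩

/-- The box `[-n, n]^d` of `ℤ^d`. -/
def box (d n : ℕ) : Set (Fin d → ℤ) := {x | ∀ i, |x i| ≤ n}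

/-- `C^n`: the vertices that can be reached from the origin by an open path contained in
`[-n, n]^d`. -/
def boxCluster {d : ℕ} (ω : Config d) (n : ℕ) : Set (Fin d → ℤ) :=
  {x | ∃ w : (openGraph ω).Walk 0 x, ∀ y ∈ w.support, y ∈ box d n}

theorem box_finite (d n : ℕ) : (box d n).Finite := by
  refine (Set.finite_Icc (fun _ : Fin d => -(n : ℤ)) (fun _ => (n : ℤ))).subset ?_
  intro x hx
  exact ⟨fun i => (abs_le.mp (hx i)).1, fun i => (abs_le.mp (hx i)).2⟩

theorem boxCluster_subset_box {d : ℕ} (ω : Config d) (n : ℕ) : boxCluster ω n ⊆ box d n :=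
  fun _ ⟨w, hw⟩ => hw _ w.end_mem_support

instance boxCluster_finite {d : ℕ} (ω : Config d) (n : ℕ) : Finite (boxCluster ω n) :=
  ((box_finite d n).subset (boxCluster_subset_box ω n)).to_subtype

/-- The boundary of `A` in `C^n`: the open (unoriented) edges with both end points in `C^n`,
one of them in `A` and the other one not in `A`. -/
def edgeBoundary {d : ℕ} (ω : Config d) (n : ℕ) (A : Set (Fin d → ℤ)) :
    Set (Sym2 (Fin d → ℤ)) :=
  {e | ∃ x ∈ boxCluster ω n, ∃ y ∈ boxCluster ω n,
    (openGraph ω).Adj x y ∧ x ∈ A ∧ y ∉ A ∧ e = s(x, y)}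

/-- The Cheeger constant `I_∞(C^n)`: the infimum of `#∂A / #A` over the nonempty `A ⊆ C^n` with
`#A ≤ #C^n / 2`. It is `+∞` if there is no such `A`, that is, if `C^n` is a single point. -/
noncomputable def cheegerConstant {d : ℕ} (ω : Config d) (n : ℕ) : EReal :=
  ⨅ (A : Set (Fin d → ℤ)) (_ : A.Nonempty) (_ : A ⊆ boxCluster ω n)
    (_ : (A.ncard : ℝ) ≤ ((boxCluster ω n).ncard : ℝ) / 2),
    ((((edgeBoundary ω n A).ncard : ℝ) / (A.ncard : ℝ) : ℝ) : EReal)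

open scoped Classical in
/-- The discrete Laplacian on `C^n`, that is, minus the generator of the random walk that jumps at
rate `1 / (2d)` along each open edge of `C^n`:
`(L f) x = (1 / (2d)) ∑ (f x - f y)`, the sum running over the neighbours `y` of `x` in `C^n`. -/
noncomputable def laplacian {d : ℕ} (ω : Config d) (n : ℕ) :
    (boxCluster ω n → ℝ) →ₗ[ℝ] (boxCluster ω n → ℝ) :=
  letI : Fintype (boxCluster ω n) := Fintype.ofFinite _
  (1 / (2 * (d : ℝ))) • Matrix.toLin' (((openGraph ω).induce (boxCluster ω n)).lapMatrix ℝ)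

/-- `λ^n`: the lowest nonzero eigenvalue of the discrete Laplacian on `C^n` (`+∞` if there is
none, that is, if `C^n` is a single point). -/
noncomputable def spectralGap {d : ℕ} (ω : Config d) (n : ℕ) : EReal :=
  ⨅ (μ : ℝ) (_ : Module.End.HasEigenvalue (laplacian ω n) μ) (_ : μ ≠ 0), (μ : EReal)

end Percolation

namespace Percolation

open MeasureTheory ProbabilityTheory unitInterval

/-! Both estimates reduce to one event, `HasSmallCut`: some part of at most half the cluster has at
most `r = ρ / n` open boundary edges per vertex. For the Cheeger constant this is immediate; for the
spectral gap it is Cheeger's inequality, which loses a square and so turns `1 / n` into `1 / n ^ 2`.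

A small cut forces an unlikely configuration. Let `C` be the cluster. Among all subsets `E` of the
whole box that split `C` with at most `r * a` open boundary edges, where `a` is the size of the
smaller part of `C`, take one whose full boundary, open and closed edges together, is smallest.
Minimality makes `E` and its complement in the box connected (`Bottleneck.linked`), hence the
boundary is connected in the sense of `Near` (`boxBoundary_linked`). As `C` is connected, some
boundary edge is open, so `1 ≤ r * a` and `a` is at least of order `n`. Isoperimetry in the box then
makes the boundary at least of order `a ^ ((d - 1) / d)`, hence of order `n ^ ((d - 1) / d)`. Since
`a` is at most the volume of the box, `r * a` is at most half of this lower bound when `ρ` is small,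
so at least half of the boundary edges are closed.

Peierls' argument finishes: connected edge sets of size `m` through a given edge number at most `K ^
(2 * m)` with `K = 3 ^ d * d`, and each is half closed with probability at most `(2 * √(1 - p)) ^
m`. For `p` near `1` the sum decays exponentially in the minimal length, and a small `ρ` makes that
length large enough to absorb the number of starting edges. -/

/-! ### Isoperimetry in the box -/

/-- The box `[-n, n]^d` as a finset. -/
noncomputable def boxFinset (d n : ℕ) : Finset (Fin d → ℤ) :=
  Fintype.piFinset fun _ => Finset.Icc (-(n : ℤ)) n

theorem mem_boxFinset {d n : ℕ} {x : Fin d → ℤ} :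
    x ∈ boxFinset d n ↔ ∀ i, -(n : ℤ) ≤ x i ∧ x i ≤ n := by
  simp [boxFinset]

theorem card_boxFinset (d n : ℕ) : (boxFinset d n).card = (2 * n + 1) ^ d := by
  simp only [boxFinset, Fintype.card_piFinset, Int.card_Icc, Finset.prod_const, Finset.card_univ,
    Fintype.card_fin]
  congr 1
  omega

/-- The lattice unit vector in direction `i`. -/
def unitVec {d : ℕ} (i : Fin d) : Fin d → ℤ := Pi.single i 1

theorem unitVec_apply {d : ℕ} (i j : Fin d) : (unitVec i) j = if j = i then (1 : ℤ) else 0 := by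
  simp [unitVec, Pi.single_apply]

/-- The pairs `(x, i)` such that the lattice edge `{x, x + eᵢ}` lies in the box and has exactly
one end point in `E`. -/
noncomputable def boxBoundary {d : ℕ} (n : ℕ) (E : Finset (Fin d → ℤ)) : Finset ((Fin d → ℤ) × Fin d) :=
  (boxFinset d n ×ˢ Finset.univ).filter fun e =>
    e.1 + unitVec e.2 ∈ boxFinset d n ∧ ¬(e.1 ∈ E ↔ e.1 + unitVec e.2 ∈ E)

theorem mem_boxBoundary {d n : ℕ} {E : Finset (Fin d → ℤ)} {x : Fin d → ℤ} {i : Fin d} :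
    (x, i) ∈ boxBoundary n E ↔ x ∈ boxFinset d n ∧ x + unitVec i ∈ boxFinset d n ∧
      ¬(x ∈ E ↔ x + unitVec i ∈ E) := by
  simp [boxBoundary]

theorem boxBoundary_sdiff {d n : ℕ} (E : Finset (Fin d → ℤ)) :
    boxBoundary n (boxFinset d n \ E) = boxBoundary n E := by
  ext ⟨x, i⟩
  simp only [mem_boxBoundary, Finset.mem_sdiff]
  tauto

theorem exists_int_crossing {P : ℤ → Prop} {l u a b : ℤ} (ha : l ≤ a ∧ a ≤ u)
    (hb : l ≤ b ∧ b ≤ u) (hPa : P a) (hPb : ¬P b) :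
    ∃ t, l ≤ t ∧ t + 1 ≤ u ∧ ¬(P t ↔ P (t + 1)) := by
  by_contra! h
  have key : ∀ t, l ≤ t → t ≤ u → (P l ↔ P t) := by
    intro t ht
    induction t, ht using Int.leInduction with
    | base => exact fun _ => Iff.rfl
    | succ t ht ih => exact fun h1 => (ih (by omega)).trans (h t ht h1)
  exact hPb ((key b hb.1 hb.2).1 ((key a ha.1 ha.2).2 hPa))

-- A line through a point of `E` either stays in `E` for all its `2 * n + 1` box points, and the
-- first summands add up to one, or it leaves `E` inside the box and so carries a boundary edge.
open Classical in
theorem one_le_tsum_line {d n : ℕ} {E : Finset (Fin d → ℤ)} (hE : E ⊆ boxFinset d n)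
    {x : Fin d → ℤ} (hx : x ∈ E) (i : Fin d) :
    (1 : ENNReal) ≤ ∑' t : ℤ, ((if Function.update x i t ∈ E then ((2 * n + 1 : ℕ) : ENNReal)⁻¹
      else 0) + ∑ j : Fin d, if (Function.update x i t, j) ∈ boxBoundary n E then 1 else 0) := by
  have hxb := mem_boxFinset.1 (hE hx)
  by_cases h : ∀ t ∈ Finset.Icc (-(n : ℤ)) n, Function.update x i t ∈ E
  · calc (1 : ENNReal) = ∑ t ∈ Finset.Icc (-(n : ℤ)) n, ((2 * n + 1 : ℕ) : ENNReal)⁻¹ := by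
          rw [Finset.sum_const, Int.card_Icc, nsmul_eq_mul,
            show ((n : ℤ) + 1 - -(n : ℤ)).toNat = 2 * n + 1 by omega]
          exact (ENNReal.mul_inv_cancel (by simp) (ENNReal.natCast_ne_top _)).symm
      _ ≤ ∑ t ∈ Finset.Icc (-(n : ℤ)) n, ((if Function.update x i t ∈ E then
            ((2 * n + 1 : ℕ) : ENNReal)⁻¹ else 0) +
            ∑ j : Fin d, if (Function.update x i t, j) ∈ boxBoundary n E then 1 else 0) := by
          refine Finset.sum_le_sum fun t ht => ?_
          rw [if_pos (h t ht)]
          exact le_self_add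
      _ ≤ _ := ENNReal.sum_le_tsum _
  · push Not at h
    obtain ⟨b, hb, hbE⟩ := h
    obtain ⟨t, h1, h2, h3⟩ := exists_int_crossing (P := fun t => Function.update x i t ∈ E)
      (l := -(n : ℤ)) (u := n) (hxb i) (Finset.mem_Icc.1 hb) (by simpa using hx) hbE
    have hup : ∀ s, -(n : ℤ) ≤ s → s ≤ n → Function.update x i s ∈ boxFinset d n := by
      intro s hs hs'
      rw [mem_boxFinset]
      intro j
      by_cases hj : j = i
      · subst hj; simp [hs, hs']
      · simpa [hj] using hxb j
    have hadd : Function.update x i t + unitVec i = Function.update x i (t + 1) := by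
      ext j
      by_cases hj : j = i
      · subst hj; simp [unitVec_apply]
      · simp [unitVec_apply, hj]
    have hmem : (Function.update x i t, i) ∈ boxBoundary n E := by
      rw [mem_boxBoundary, hadd]
      exact ⟨hup _ h1 (by omega), hup _ (by omega) h2, h3⟩
    refine le_trans ?_ (ENNReal.le_tsum t)
    refine le_trans ?_ le_add_self
    refine le_trans ?_ (Finset.single_le_sum (f := fun j => if (Function.update x i t, j) ∈
      boxBoundary n E then (1 : ENNReal) else 0) (fun _ _ => zero_le) (Finset.mem_univ i))
    simp [hmem]

-- A discrete Gagliardo–Nirenberg (Loomis–Whitney) argument: the weight `f` below has sum at least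
-- one on every axis line through `E`. The term in `(2 * n + 1)⁻¹` pays for lines that never leave
-- `E`, since faces of the box do not count as boundary.
open Classical in
theorem card_le_rpow_boundary {d n : ℕ} (hd : 2 ≤ d) {E : Finset (Fin d → ℤ)}
    (hE : E ⊆ boxFinset d n) :
    (E.card : ENNReal) ≤ ((E.card : ENNReal) * ((2 * n + 1 : ℕ) : ENNReal)⁻¹ +
      (boxBoundary n E).card) ^ ((d : ℝ) / (d - 1)) := by
  set f : (Fin d → ℤ) → ENNReal := fun x => (if x ∈ E then ((2 * n + 1 : ℕ) : ENNReal)⁻¹ else 0) +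
    ∑ j : Fin d, if (x, j) ∈ boxBoundary n E then 1 else 0 with hf
  have hd' : (2 : ℝ) ≤ d := by exact_mod_cast hd
  have hp : Real.HolderConjugate (Fintype.card (Fin d)) ((d : ℝ) / (d - 1)) := by
    rw [Fintype.card_fin, Real.holderConjugate_iff]
    refine ⟨by linarith, ?_⟩
    have : (d : ℝ) - 1 ≠ 0 := by linarith
    field_simp
    ring
  -- With counting measure, this bounds the sum over points of the product over directions of the
  -- powered line sums of `f` by a power of the total sum of `f`.
  have key := lintegral_prod_lintegral_pow_le (fun _ : Fin d => (Measure.count : Measure ℤ)) hp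
    (f := f) (measurable_of_countable f)
  have hsing : ∀ x : Fin d → ℤ,
      (Measure.pi fun _ : Fin d => (Measure.count : Measure ℤ)) {x} = 1 := by
    intro x; simp [Measure.pi_singleton]
  simp only [lintegral_countable', hsing, mul_one, Measure.count_singleton] at key
  have hR : ∑' x, f x = (E.card : ENNReal) * ((2 * n + 1 : ℕ) : ENNReal)⁻¹ +
      (boxBoundary n E).card := by
    rw [tsum_eq_sum (s := boxFinset d n)]
    · rw [hf, Finset.sum_add_distrib]
      congr 1
      · rw [← Finset.sum_filter, Finset.filter_mem_eq_inter, Finset.inter_eq_right.2 hE]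
        simp
      · rw [← Finset.sum_product', Finset.sum_ite]
        simp only [Finset.sum_const, nsmul_eq_mul, mul_one, mul_zero, add_zero]
        congr 2
        ext ⟨x, i⟩
        simp only [Finset.mem_filter, Finset.mem_product, Finset.mem_univ, and_true,
          mem_boxBoundary]
        tauto
    · intro x hx
      have h1 : x ∉ E := fun h => hx (hE h)
      simp [hf, h1, mem_boxBoundary, hx]
  rw [hR] at key
  refine le_trans ?_ key
  calc (E.card : ENNReal) = ∑ x ∈ E, 1 := by simp
    _ ≤ _ := by
      refine le_trans (Finset.sum_le_sum fun x hx => ?_) (ENNReal.sum_le_tsum E)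
      refine Finset.one_le_prod'' fun i => ?_
      refine ENNReal.one_le_rpow (one_le_tsum_line hE hx i) ?_
      rw [Fintype.card_fin]
      apply div_pos <;> linarith

/-- The constant in the isoperimetric inequality of the box. -/
noncomputable def isoConst (d : ℕ) : ℝ := 1 - (1 / 2 : ℝ) ^ (1 / (d : ℝ))

theorem isoConst_pos {d : ℕ} (hd : 2 ≤ d) : 0 < isoConst d := by
  have : (0 : ℝ) < d := by exact_mod_cast (by omega : 0 < d)
  have := Real.rpow_lt_one (x := 1 / 2) (z := 1 / (d : ℝ)) (by norm_num) (by norm_num)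
    (by positivity)
  unfold isoConst
  linarith

/-- Isoperimetric inequality in the box. -/
theorem isoperimetry {d n : ℕ} (hd : 2 ≤ d) {E : Finset (Fin d → ℤ)}
    (hE : E ⊆ boxFinset d n) (hcard : 2 * E.card ≤ (boxFinset d n).card) :
    isoConst d * (E.card : ℝ) ^ (((d : ℝ) - 1) / d) ≤ (boxBoundary n E).card := by
  have hd' : (2 : ℝ) ≤ d := by exact_mod_cast hd
  have h := card_le_rpow_boundary hd hE
  have hN : (0 : ℝ) < 2 * n + 1 := by positivity
  set a : ℝ := (E.card : ℝ) with ha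
  set b : ℝ := ((boxBoundary n E).card : ℝ) with hb
  have ha0 : 0 ≤ a := by positivity
  have hb0 : 0 ≤ b := by positivity
  have h1 : a ≤ (a * (2 * n + 1 : ℝ)⁻¹ + b) ^ ((d : ℝ) / (d - 1)) := by
    have h2 := ENNReal.toReal_mono (ENNReal.rpow_ne_top_of_nonneg
      (div_nonneg (by linarith) (by linarith)) (ENNReal.add_ne_top.2
        ⟨ENNReal.mul_ne_top (ENNReal.natCast_ne_top _) (by simp), ENNReal.natCast_ne_top _⟩)) h
    rw [← ENNReal.toReal_rpow, ENNReal.toReal_add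
      (ENNReal.mul_ne_top (ENNReal.natCast_ne_top _) (by simp)) (ENNReal.natCast_ne_top _),
      ENNReal.toReal_mul, ENNReal.toReal_inv] at h2
    simp only [ENNReal.toReal_natCast] at h2
    push_cast at h2
    exact h2
  have h3 : a ^ (((d : ℝ) - 1) / d) ≤ a * (2 * n + 1 : ℝ)⁻¹ + b := by
    have h4 := Real.rpow_le_rpow ha0 h1 (z := ((d : ℝ) - 1) / d)
      (div_nonneg (by linarith) (by linarith))
    rwa [← Real.rpow_mul (by positivity), show (d : ℝ) / (d - 1) * ((d - 1) / d) = 1 by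
      have : (d : ℝ) - 1 ≠ 0 := by linarith
      field_simp, Real.rpow_one] at h4
  -- The full-line term is absorbed on the left: `E` fills at most half of the box, which gains the
  -- factor `(1 / 2) ^ (1 / d) < 1` and explains the value of `isoConst`.
  have h5 : a * (2 * n + 1 : ℝ)⁻¹ ≤ (1 / 2 : ℝ) ^ (1 / (d : ℝ)) * a ^ (((d : ℝ) - 1) / d) := by
    have h6 : a ^ (1 / (d : ℝ)) ≤ (1 / 2 : ℝ) ^ (1 / (d : ℝ)) * (2 * n + 1) := by
      have h7 : a ≤ 1 / 2 * (2 * n + 1) ^ (d : ℝ) := by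
        rw [card_boxFinset] at hcard
        have : (2 * a : ℝ) ≤ (2 * n + 1) ^ d := by rw [ha]; exact_mod_cast hcard
        rw [Real.rpow_natCast]; linarith
      calc a ^ (1 / (d : ℝ)) ≤ (1 / 2 * (2 * n + 1) ^ (d : ℝ)) ^ (1 / (d : ℝ)) :=
            Real.rpow_le_rpow ha0 h7 (by positivity)
        _ = _ := by
            rw [Real.mul_rpow (by norm_num) (by positivity), ← Real.rpow_mul hN.le,
              mul_one_div_cancel (by linarith), Real.rpow_one]
    have h8 : a = a ^ (1 / (d : ℝ)) * a ^ (((d : ℝ) - 1) / d) := by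
      rw [← Real.rpow_add_of_nonneg ha0 (by positivity)
        (div_nonneg (by linarith) (by linarith)), show 1 / (d : ℝ) + (d - 1) / d = 1 by
        rw [← add_div, add_sub_cancel, div_self (by linarith)], Real.rpow_one]
    rw [← div_eq_mul_inv, div_le_iff₀ hN]
    calc a = a ^ (1 / (d : ℝ)) * a ^ (((d : ℝ) - 1) / d) := h8
      _ ≤ ((1 / 2 : ℝ) ^ (1 / (d : ℝ)) * (2 * n + 1)) * a ^ (((d : ℝ) - 1) / d) :=
          mul_le_mul_of_nonneg_right h6 (Real.rpow_nonneg ha0 _)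
      _ = _ := by ring
  unfold isoConst
  linarith

theorem isoperimetry_min {d n : ℕ} (hd : 2 ≤ d) {E : Finset (Fin d → ℤ)}
    (hE : E ⊆ boxFinset d n) {a : ℝ} (ha0 : 0 ≤ a) (ha : a ≤ E.card)
    (ha' : a ≤ (boxFinset d n \ E).card) :
    isoConst d * a ^ (((d : ℝ) - 1) / d) ≤ (boxBoundary n E).card := by
  have hd' : (2 : ℝ) ≤ d := by exact_mod_cast hd
  have hcs := Finset.card_sdiff_add_card_eq_card hE
  have hmono : ∀ b : ℝ, a ≤ b → isoConst d * a ^ (((d : ℝ) - 1) / d) ≤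
      isoConst d * b ^ (((d : ℝ) - 1) / d) := fun b hb =>
    mul_le_mul_of_nonneg_left (Real.rpow_le_rpow ha0 hb (div_nonneg (by linarith) (by linarith)))
      (isoConst_pos hd).le
  rcases le_total E.card (boxFinset d n \ E).card with h | h
  · exact (hmono _ ha).trans (isoperimetry hd hE (by omega))
  · rw [← boxBoundary_sdiff E]
    exact (hmono _ ha').trans (isoperimetry hd Finset.sdiff_subset (by omega))

/-! ### Discrete Poincaré lemma and connectivity of boundaries -/

/-- The coordinate sum, shifted to be nonnegative on the box. -/
def height {d : ℕ} (n : ℕ) (x : Fin d → ℤ) : ℕ := (∑ i, (x i + n)).toNat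

theorem sum_add_unitVec {d n : ℕ} (x : Fin d → ℤ) (i : Fin d) :
    ∑ j, ((x + unitVec i) j + (n : ℤ)) = ∑ j, (x j + (n : ℤ)) + 1 := by
  simp only [Pi.add_apply, unitVec_apply, Finset.sum_add_distrib]
  simp
  ring

theorem height_add_unitVec {d n : ℕ} {x : Fin d → ℤ} (hx : x ∈ boxFinset d n) (i : Fin d) :
    height n (x + unitVec i) = height n x + 1 := by
  have h0 : 0 ≤ ∑ j, (x j + (n : ℤ)) :=
    Finset.sum_nonneg fun j _ => by have := (mem_boxFinset.1 hx j).1; omega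
  unfold height
  rw [sum_add_unitVec]
  omega

/-- Every coordinate of the two other corners already occurs, in the same place, in one of the two
given corners. -/
theorem mem_box_of_square {d n : ℕ} {z : Fin d → ℤ} {i j : Fin d} (hij : i ≠ j)
    (hi : z + unitVec i ∈ boxFinset d n) (hj : z + unitVec j ∈ boxFinset d n) :
    z ∈ boxFinset d n ∧ z + unitVec i + unitVec j ∈ boxFinset d n := by
  simp only [mem_boxFinset, Pi.add_apply, unitVec_apply] at *
  refine ⟨fun k => ?_, fun k => ?_⟩ <;>
  · have h1 := hi k
    have h2 := hj k
    by_cases hk : k = i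
    · have hk' : k ≠ j := fun h => hij (hk.symm.trans h)
      simp only [if_pos hk, if_neg hk'] at *
      omega
    · simp only [if_neg hk] at *
      split_ifs at * <;> omega

/-- Discrete Poincaré lemma in the box: a one-form that is closed on unit squares is exact. -/
theorem exists_potential {M : Type*} [AddCommGroup M] {d n : ℕ} (w : (Fin d → ℤ) → Fin d → M)
    (hw : ∀ x i j, i ≠ j → x ∈ boxFinset d n → x + unitVec i ∈ boxFinset d n →
      x + unitVec j ∈ boxFinset d n → x + unitVec i + unitVec j ∈ boxFinset d n →
      w x i + w (x + unitVec i) j = w x j + w (x + unitVec j) i) :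
    ∃ f : (Fin d → ℤ) → M, ∀ x i, x ∈ boxFinset d n → x + unitVec i ∈ boxFinset d n →
      f (x + unitVec i) = f x + w x i := by
  classical
  have step : ∀ h : ℕ, ∃ f : (Fin d → ℤ) → M, ∀ x i, x ∈ boxFinset d n →
      x + unitVec i ∈ boxFinset d n → height n (x + unitVec i) ≤ h →
      f (x + unitVec i) = f x + w x i := by
    intro h
    induction h with
    | zero =>
      refine ⟨fun _ => 0, fun x i hx _ hh => ?_⟩
      rw [height_add_unitVec hx] at hh
      omega
    | succ h ih =>
      obtain ⟨f, hf⟩ := ih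
      -- The potential is extended one height level at a time, through an arbitrarily chosen
      -- predecessor in the box; closedness on squares shows that the choice is immaterial.
      refine ⟨fun x => if height n x ≤ h then f x else
        if hx : ∃ i, x - unitVec i ∈ boxFinset d n then
          f (x - unitVec hx.choose) + w (x - unitVec hx.choose) hx.choose else 0, ?_⟩
      intro x i hx hxi hh
      have hhx := height_add_unitVec hx i
      have hxh : height n x ≤ h := by omega
      by_cases hle : height n (x + unitVec i) ≤ h
      · simp only [hle, hxh, if_true]
        exact hf x i hx hxi hle
      · have hex : ∃ j, x + unitVec i - unitVec j ∈ boxFinset d n := ⟨i, by simpa using hx⟩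
        simp only [hle, hxh, if_true, if_false, hex, dif_pos]
        set j := hex.choose with hj
        have hjs := hex.choose_spec
        rw [← hj] at hjs
        by_cases hij : i = j
        · rw [← hij]; simp
        -- The two predecessors `x` and `z + unitVec i` have the common predecessor `z`, at which
        -- `f` is already a potential; the square over `z` compares the two values.
        · set z := x - unitVec j with hz
          have e1 : x + unitVec i - unitVec j = z + unitVec i := by rw [hz]; abel
          have e2 : x = z + unitVec j := by rw [hz]; abel
          rw [e1] at hjs ⊢
          have hx' : z + unitVec j ∈ boxFinset d n := by rwa [← e2]
          obtain ⟨hzb, hzz⟩ := mem_box_of_square hij hjs hx'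
          have hz1 := height_add_unitVec hzb i
          have hz2 := height_add_unitVec hzb j
          rw [← e2] at hz2
          rw [hf z i hzb hjs (by omega), e2, hf z j hzb hx' (by rw [← e2]; omega), add_assoc,
            add_assoc, hw z i j hij hzb hjs hx' hzz]
  obtain ⟨f, hf⟩ := step ((boxFinset d n).sup (height n))
  exact ⟨f, fun x i hx hxi => hf x i hx hxi (Finset.le_sup (f := height n) hxi)⟩

/-- A finset is linked for a relation if no proper nonempty part of it is unrelated to the rest. -/
def Linked {α : Type*} [DecidableEq α] (r : α → α → Prop) (S : Finset α) : Prop :=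
  ∀ T ⊆ S, T.Nonempty → (∀ x ∈ T, ∀ y ∈ S \ T, ¬r x y) → T = S

/-- Lattice adjacency through unit vectors. -/
def Neighbour {d : ℕ} (x y : Fin d → ℤ) : Prop := ∃ i, y = x + unitVec i ∨ x = y + unitVec i

/-- Two edges are near if their base points are at sup-distance at most one. -/
def Near {d : ℕ} (e e' : (Fin d → ℤ) × Fin d) : Prop := ∀ k, |e.1 k - e'.1 k| ≤ 1

theorem Near.symm {d : ℕ} {e e' : (Fin d → ℤ) × Fin d} (h : Near e e') : Near e' e :=
  fun k => by rw [abs_sub_comm]; exact h k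

theorem near_of_unitVec {d : ℕ} (x : Fin d → ℤ) (i j k l : Fin d) :
    Near (x, k) (x, l) ∧ Near (x, k) (x + unitVec i, l) ∧
      Near (x + unitVec i, k) (x + unitVec j, l) := by
  refine ⟨fun m => by simp, fun m => ?_, fun m => ?_⟩
  · simp only [Pi.add_apply, unitVec_apply]
    split_ifs <;> simp
  · simp only [Pi.add_apply, unitVec_apply]
    split_ifs <;> simp

theorem Linked.eq_of_forall {d : ℕ} {M : Type*} {E : Finset (Fin d → ℤ)} (hE : Linked Neighbour E)
    {f : (Fin d → ℤ) → M} (hf : ∀ x i, x ∈ E → x + unitVec i ∈ E → f (x + unitVec i) = f x)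
    {x y : Fin d → ℤ} (hx : x ∈ E) (hy : y ∈ E) : f x = f y := by
  classical
  have h := hE (E.filter fun z => f z = f x) (Finset.filter_subset _ _)
    ⟨x, by simp [hx]⟩ ?_
  · rw [← h, Finset.mem_filter] at hy
    exact hy.2.symm
  · rintro u hu v hv ⟨i, rfl | rfl⟩
    · simp only [Finset.mem_filter, Finset.mem_sdiff] at hu hv
      exact hv.2 ⟨hv.1, (hf u i hu.1 hv.1).trans hu.2⟩
    · simp only [Finset.mem_filter, Finset.mem_sdiff] at hu hv
      exact hv.2 ⟨hv.1, (hf v i hv.1 hu.1).symm.trans hu.2⟩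

/-- Boundary connectivity: if a set and its complement in the box are both connected, then the
boundary edges between them are linked. -/
theorem boxBoundary_linked {d n : ℕ} {E : Finset (Fin d → ℤ)} (hE : E ⊆ boxFinset d n)
    (h1 : Linked Neighbour E) (h2 : Linked Neighbour (boxFinset d n \ E)) :
    Linked Near (boxBoundary n E) := by
  classical
  intro T hT hTne hsep
  have hiff : ∀ e ∈ boxBoundary n E, ∀ e' ∈ boxBoundary n E, Near e e' → (e ∈ T ↔ e' ∈ T) := by
    intro e he e' he' hn
    constructor
    · intro h; by_contra h'
      exact hsep e h e' (Finset.mem_sdiff.2 ⟨he', h'⟩) hn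
    · intro h; by_contra h'
      exact hsep e' h e (Finset.mem_sdiff.2 ⟨he, h'⟩) hn.symm
  -- Modulo 2 the boundary of `E` is the coboundary of its indicator. A part `T` of the boundary
  -- with no near edges outside it is again closed, hence has a potential `f`, which is constant on
  -- `E` and on its complement. So `f` jumps either on all boundary edges or on none.
  let χ : (Fin d → ℤ) → ZMod 2 := fun x => if x ∈ E then 1 else 0
  have hχ : ∀ x i, x ∈ boxFinset d n → x + unitVec i ∈ boxFinset d n →
      χ x + χ (x + unitVec i) = if (x, i) ∈ boxBoundary n E then 1 else 0 := by
    intro x i hx hxi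
    simp only [χ, mem_boxBoundary, hx, hxi, true_and]
    by_cases ha : x ∈ E <;> by_cases hb : x + unitVec i ∈ E <;> simp [ha, hb]
    decide
  obtain ⟨f, hf⟩ := exists_potential (n := n)
    (fun x i => if (x, i) ∈ T then (1 : ZMod 2) else 0) (by
      intro x i j hij hx hxi hxj hxij
      have hxji : x + unitVec j + unitVec i ∈ boxFinset d n := by rwa [add_right_comm]
      -- The four edges of a unit square are pairwise near, so on a square `T` is either empty or
      -- equal to the whole boundary.
      by_cases hany : (x, i) ∈ T ∨ (x + unitVec i, j) ∈ T ∨ (x, j) ∈ T ∨ (x + unitVec j, i) ∈ T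
      · obtain ⟨e, heT, hne⟩ : ∃ e ∈ T, Near e (x, i) ∧ Near e (x + unitVec i, j) ∧
            Near e (x, j) ∧ Near e (x + unitVec j, i) := by
          rcases hany with h | h | h | h
          · exact ⟨_, h, (near_of_unitVec x i i i i).1, (near_of_unitVec x i i i j).2.1,
              (near_of_unitVec x i i i j).1, (near_of_unitVec x j i i i).2.1⟩
          · exact ⟨_, h, (near_of_unitVec x i i i j).2.1.symm, (near_of_unitVec x i i j j).2.2,
              (near_of_unitVec x i i j j).2.1.symm, (near_of_unitVec x i j j i).2.2⟩
          · exact ⟨_, h, (near_of_unitVec x i i j i).1, (near_of_unitVec x i i j j).2.1,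
              (near_of_unitVec x i i j j).1, (near_of_unitVec x j i j i).2.1⟩
          · exact ⟨_, h, (near_of_unitVec x j i i i).2.1.symm, (near_of_unitVec x j i i j).2.2,
              (near_of_unitVec x j i j i).2.1.symm, (near_of_unitVec x j j i i).2.2⟩
        have hTB : ∀ e', Near e e' → (e' ∈ T ↔ e' ∈ boxBoundary n E) := fun e' he' =>
          ⟨fun h => hT h, fun h => (hiff e (hT heT) e' h he').1 heT⟩
        rw [if_congr (hTB _ hne.1) rfl rfl, if_congr (hTB _ hne.2.1) rfl rfl,
          if_congr (hTB _ hne.2.2.1) rfl rfl, if_congr (hTB _ hne.2.2.2) rfl rfl,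
          ← hχ x i hx hxi, ← hχ _ j hxi hxij, ← hχ x j hx hxj, ← hχ _ i hxj hxji,
          add_right_comm x (unitVec j)]
        have h2 : ∀ a : ZMod 2, a + a = 0 := by decide
        linear_combination h2 (χ (x + unitVec i)) - h2 (χ (x + unitVec j))
      · push Not at hany
        simp [hany])
  have hconst : ∀ F : Finset (Fin d → ℤ), F ⊆ boxFinset d n →
      boxBoundary n F = boxBoundary n E → Linked Neighbour F →
      ∀ x ∈ F, ∀ y ∈ F, f x = f y := by
    intro F hF hFE hl x hx y hy
    refine hl.eq_of_forall (fun u i hu hui => ?_) hx hy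
    have hnot : (u, i) ∉ T := fun h => by
      have := hT h
      rw [← hFE, mem_boxBoundary] at this
      exact this.2.2 ⟨fun _ => hui, fun _ => hu⟩
    rw [hf u i (hF hu) (hF hui), if_neg hnot, add_zero]
  have hE1 : ∀ x ∈ boxFinset d n, ∀ y ∈ boxFinset d n, (x ∈ E ↔ y ∈ E) → f x = f y := by
    intro x hx y hy hxy
    by_cases hxE : x ∈ E
    · exact hconst E hE rfl h1 x hxE y (hxy.1 hxE)
    · exact hconst _ Finset.sdiff_subset (boxBoundary_sdiff E) h2 x
        (Finset.mem_sdiff.2 ⟨hx, hxE⟩) y (Finset.mem_sdiff.2 ⟨hy, fun h => hxE (hxy.2 h)⟩)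
  obtain ⟨⟨a, i⟩, haT⟩ := hTne
  refine Finset.Subset.antisymm hT ?_
  rintro ⟨b, j⟩ hb
  by_contra hbT
  have ha := mem_boxBoundary.1 (hT haT)
  have hb := mem_boxBoundary.1 hb
  have hfa := hf a i ha.1 ha.2.1
  have hfb := hf b j hb.1 hb.2.1
  rw [if_pos haT] at hfa
  rw [if_neg hbT, add_zero] at hfb
  have hane : f (a + unitVec i) ≠ f a := by rw [hfa]; simp
  apply hane
  by_cases hab : a ∈ E ↔ b ∈ E
  · rw [hE1 a ha.1 b hb.1 hab, hE1 _ ha.2.1 _ hb.2.1 (by tauto), hfb]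
  · rw [hE1 a ha.1 _ hb.2.1 (by tauto), hE1 _ ha.2.1 b hb.1 (by tauto), hfb]

/-! ### Bottlenecks with minimal boundary -/

theorem boxBoundary_nonempty {d n : ℕ} (hd : 2 ≤ d) {E : Finset (Fin d → ℤ)}
    (hE : E ⊆ boxFinset d n) (h1 : E.Nonempty) (h2 : (boxFinset d n \ E).Nonempty) :
    (boxBoundary n E).Nonempty := by
  have h := isoperimetry_min hd hE zero_le_one (by exact_mod_cast h1.card_pos)
    (by exact_mod_cast h2.card_pos)
  rw [Real.one_rpow, mul_one] at h
  exact Finset.card_pos.1 (by exact_mod_cast (isoConst_pos hd).trans_le h)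

/-- Splitting a set into two parts without adjacent points splits its boundary. -/
theorem boxBoundary_split {d n : ℕ} {E T : Finset (Fin d → ℤ)}
    (hT : T ⊆ E) (hsep : ∀ x ∈ T, ∀ y ∈ E \ T, ¬Neighbour x y) :
    Disjoint (boxBoundary n T) (boxBoundary n (E \ T)) ∧
      boxBoundary n E = boxBoundary n T ∪ boxBoundary n (E \ T) := by
  have hs : ∀ x i, (x ∈ T → x + unitVec i ∉ E \ T) ∧ (x + unitVec i ∈ T → x ∉ E \ T) := fun x i =>
    ⟨fun h h' => hsep _ h _ h' ⟨i, Or.inl rfl⟩, fun h h' => hsep _ h _ h' ⟨i, Or.inr rfl⟩⟩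
  simp only [Finset.mem_sdiff] at hs
  constructor
  · rw [Finset.disjoint_left]
    rintro ⟨x, i⟩ h h'
    rw [mem_boxBoundary] at h h'
    simp only [Finset.mem_sdiff] at h h'
    have := hs x i
    tauto
  · ext ⟨x, i⟩
    simp only [mem_boxBoundary, Finset.mem_union, Finset.mem_sdiff]
    have := hs x i
    have h1 := @hT x
    have h2 := @hT (x + unitVec i)
    by_cases a1 : x ∈ T <;> by_cases a2 : x + unitVec i ∈ T <;> by_cases a3 : x ∈ E <;>
      by_cases a4 : x + unitVec i ∈ E <;> simp_all

/-- The sets that split `C` with at most `r` times the smaller part of `C` marked boundary edges. -/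
def Bottleneck {d : ℕ} (n : ℕ) (C : Finset (Fin d → ℤ)) (P : (Fin d → ℤ) × Fin d → Prop)
    [DecidablePred P] (r : ℝ) (E : Finset (Fin d → ℤ)) : Prop :=
  E ⊆ boxFinset d n ∧ (E ∩ C).Nonempty ∧ (C \ E).Nonempty ∧
    ((boxBoundary n E).filter P).card ≤ r * min ((E ∩ C).card : ℝ) ((C \ E).card : ℝ)

/-- Because of this symmetry, the complement of a minimiser is a minimiser, and connectedness of
both sides follows from a single argument. This is why `E` ranges over subsets of the box and not of
`C`. -/
theorem Bottleneck.compl {d n : ℕ} {C : Finset (Fin d → ℤ)} {P : (Fin d → ℤ) × Fin d → Prop}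
    [DecidablePred P] {r : ℝ} {E : Finset (Fin d → ℤ)} (hC : C ⊆ boxFinset d n)
    (h : Bottleneck n C P r E) : Bottleneck n C P r (boxFinset d n \ E) := by
  obtain ⟨h1, h2, h3, h4⟩ := h
  have e1 : (boxFinset d n \ E) ∩ C = C \ E := by
    ext x; have := @hC x; simp only [Finset.mem_inter, Finset.mem_sdiff]; tauto
  have e2 : C \ (boxFinset d n \ E) = E ∩ C := by
    ext x; have := @hC x; simp only [Finset.mem_inter, Finset.mem_sdiff]; tauto
  exact ⟨Finset.sdiff_subset, by rwa [e1], by rwa [e2], by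
    rwa [e1, e2, boxBoundary_sdiff, min_comm]⟩

/-- A bottleneck of smallest boundary is connected. -/
theorem Bottleneck.linked {d n : ℕ} (hd : 2 ≤ d) {C : Finset (Fin d → ℤ)}
    {P : (Fin d → ℤ) × Fin d → Prop} [DecidablePred P] {r : ℝ} (hr : 0 ≤ r)
    {E : Finset (Fin d → ℤ)} (hC : C ⊆ boxFinset d n) (h : Bottleneck n C P r E)
    (hmin : ∀ F, Bottleneck n C P r F → (boxBoundary n E).card ≤ (boxBoundary n F).card) :
    Linked Neighbour E := by
  obtain ⟨hE, hEC, hCE, hle⟩ := h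
  obtain ⟨c, hc⟩ := hCE
  rw [Finset.mem_sdiff] at hc
  -- A nonempty part of `E` with nonempty remainder is not a bottleneck.
  have hno : ∀ T ⊆ E, (E \ T).Nonempty →
      (∀ x ∈ T, ∀ y ∈ E \ T, ¬Neighbour x y) → ¬Bottleneck n C P r T := by
    intro T hT hU hsep hB
    obtain ⟨hdis, hun⟩ := boxBoundary_split (n := n) hT hsep
    have h1 := hmin T hB
    have h2 := (boxBoundary_nonempty hd (Finset.sdiff_subset.trans hE) hU
      ⟨c, Finset.mem_sdiff.2 ⟨hC hc.1, fun h => hc.2 (Finset.mem_sdiff.1 h).1⟩⟩).card_pos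
    rw [hun, Finset.card_union_of_disjoint hdis] at h1
    omega
  intro T hT hTne hsep
  by_contra hTE
  have hU : (E \ T).Nonempty := by
    rw [Finset.sdiff_nonempty]
    exact fun h => hTE (Finset.Subset.antisymm hT h)
  have eT : E \ (E \ T) = T := by rw [Finset.sdiff_sdiff_eq_self hT]
  have hsep' : ∀ x ∈ E \ T, ∀ y ∈ E \ (E \ T), ¬Neighbour x y := by
    rw [eT]
    rintro x hx y hy ⟨i, hi⟩
    exact hsep y hy x hx ⟨i, hi.symm⟩
  have n1 := hno T hT hU hsep
  have n2 := hno (E \ T) Finset.sdiff_subset (by rwa [eT]) hsep'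
  obtain ⟨hdis, hun⟩ := boxBoundary_split (n := n) hT hsep
  have ho : (((boxBoundary n E).filter P).card : ℝ) =
      ((boxBoundary n T).filter P).card + ((boxBoundary n (E \ T)).filter P).card := by
    rw [hun, Finset.filter_union, Finset.card_union_of_disjoint
      (Finset.disjoint_filter_filter hdis)]
    push_cast; rfl
  have hm : ((E ∩ C).card : ℝ) = (T ∩ C).card + ((E \ T) ∩ C).card := by
    rw [← Nat.cast_add, ← Finset.card_union_of_disjoint]
    · congr 2
      rw [← Finset.union_inter_distrib_right, Finset.union_sdiff_of_subset hT]
    · exact (Finset.disjoint_sdiff.mono Finset.inter_subset_left Finset.inter_subset_left)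
  have hmono : ∀ S ⊆ E, ((C \ E).card : ℝ) ≤ (C \ S).card := fun S hS => by
    exact_mod_cast Finset.card_le_card (Finset.sdiff_subset_sdiff le_rfl hS)
  have hne : ∀ S ⊆ E, (C \ S).Nonempty := fun S hS =>
    ⟨c, Finset.mem_sdiff.2 ⟨hc.1, fun h => hc.2 (hS h)⟩⟩
  have key : ∀ S, S ⊆ E → ¬Bottleneck n C P r S → (S ∩ C).Nonempty →
      r * min ((S ∩ C).card : ℝ) ((C \ S).card : ℝ) < ((boxBoundary n S).filter P).card := by
    intro S hS hB hne'
    by_contra! hlt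
    exact hB ⟨hS.trans hE, hne', hne S hS, hlt⟩
  have hT' := hmono T hT
  have hU' := hmono (E \ T) Finset.sdiff_subset
  by_cases a1 : (T ∩ C).Nonempty <;> by_cases a2 : ((E \ T) ∩ C).Nonempty
  · have k1 := key T hT n1 a1
    have k2 := key _ Finset.sdiff_subset n2 a2
    -- Marked edges add up exactly over the two parts, while the size of the smaller side is
    -- subadditive. If both parts exceed the ratio `r`, so does `E`.
    have hsum : min ((E ∩ C).card : ℝ) ((C \ E).card : ℝ) ≤
        min ((T ∩ C).card : ℝ) ((C \ T).card : ℝ) +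
        min (((E \ T) ∩ C).card : ℝ) ((C \ (E \ T)).card : ℝ) := by
      have p1 : (0 : ℝ) ≤ (T ∩ C).card := by positivity
      have p2 : (0 : ℝ) ≤ ((E \ T) ∩ C).card := by positivity
      have p3 : (0 : ℝ) ≤ (C \ T).card := by positivity
      have p4 : (0 : ℝ) ≤ (C \ (E \ T)).card := by positivity
      have p5 := min_le_left ((E ∩ C).card : ℝ) ((C \ E).card : ℝ)
      have p6 := min_le_right ((E ∩ C).card : ℝ) ((C \ E).card : ℝ)
      rcases min_cases ((T ∩ C).card : ℝ) ((C \ T).card : ℝ) with q | q <;>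
      rcases min_cases (((E \ T) ∩ C).card : ℝ) ((C \ (E \ T)).card : ℝ) with q' | q' <;>
      linarith
    have := mul_le_mul_of_nonneg_left hsum hr
    rw [mul_add] at this
    linarith
  -- When one part misses `C`, the other meets `C` in the same set as `E` and has no more marked
  -- edges, so it would still be a bottleneck.
  · have k1 := key T hT n1 a1
    rw [Finset.not_nonempty_iff_eq_empty] at a2
    rw [a2] at hm
    simp only [Finset.card_empty, Nat.cast_zero, add_zero] at hm
    have := mul_le_mul_of_nonneg_left (min_le_min hm.le hT') hr
    have : (0 : ℝ) ≤ ((boxBoundary n (E \ T)).filter P).card := by positivity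
    linarith
  · have k1 := key _ Finset.sdiff_subset n2 a2
    rw [Finset.not_nonempty_iff_eq_empty] at a1
    rw [a1] at hm
    simp only [Finset.card_empty, Nat.cast_zero, zero_add] at hm
    have := mul_le_mul_of_nonneg_left (min_le_min hm.le hU') hr
    have : (0 : ℝ) ≤ ((boxBoundary n T).filter P).card := by positivity
    linarith
  · rw [Finset.not_nonempty_iff_eq_empty] at a1 a2
    rw [a1, a2] at hm
    simp at hm
    exact hEC.ne_empty hm

/-- If there is a bottleneck, then there is one whose boundary is linked. -/
theorem Bottleneck.exists_linked {d n : ℕ} (hd : 2 ≤ d) {C : Finset (Fin d → ℤ)}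
    {P : (Fin d → ℤ) × Fin d → Prop} [DecidablePred P] {r : ℝ} (hr : 0 ≤ r)
    {A : Finset (Fin d → ℤ)} (hC : C ⊆ boxFinset d n) (h : Bottleneck n C P r A) :
    ∃ E, Bottleneck n C P r E ∧ Linked Near (boxBoundary n E) := by
  classical
  have hex : ∃ m E, Bottleneck n C P r E ∧ (boxBoundary n E).card = m := ⟨_, A, h, rfl⟩
  obtain ⟨E, hE, hEm⟩ := Nat.find_spec hex
  have hmin : ∀ F, Bottleneck n C P r F → (boxBoundary n E).card ≤ (boxBoundary n F).card :=
    fun F hF => hEm ▸ Nat.find_min' hex ⟨F, hF, rfl⟩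
  refine ⟨E, hE, boxBoundary_linked hE.1 (hE.linked hd hr hC hmin)
    ((hE.compl hC).linked hd hr hC ?_)⟩
  rw [boxBoundary_sdiff]
  exact hmin

/-! ### Counting linked sets by walks -/

/-- The vertex sets of the walks of length `k` from `v`, where `N v` lists the neighbours. -/
def walkSupports {α : Type*} [DecidableEq α] (N : α → Finset α) : ℕ → α → Finset (Finset α)
  | 0, v => {{v}}
  | k + 1, v => (N v).biUnion fun u => (walkSupports N k u).image (insert v)

theorem card_walkSupports_le {α : Type*} [DecidableEq α] {N : α → Finset α} {K : ℕ}
    (hN : ∀ v, (N v).card ≤ K) (k : ℕ) (v : α) : (walkSupports N k v).card ≤ K ^ k := by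
  induction k generalizing v with
  | zero => simp [walkSupports]
  | succ k ih =>
    rw [walkSupports, pow_succ']
    exact (Finset.card_biUnion_le_card_mul _ _ _ fun u _ => Finset.card_image_le.trans (ih u)).trans
      (Nat.mul_le_mul_right _ (hN v))

theorem mem_walkSupports_succ {α : Type*} [DecidableEq α] {N : α → Finset α} {k : ℕ} {u v : α}
    {T : Finset α} (hu : u ∈ N v) (hT : T ∈ walkSupports N k u) :
    insert v T ∈ walkSupports N (k + 1) v :=
  Finset.mem_biUnion.2 ⟨u, hu, Finset.mem_image_of_mem _ hT⟩

/-- A walk through `a` can be given the detour `a, b, a`, which costs two steps. -/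
theorem insert_mem_walkSupports {α : Type*} [DecidableEq α] {N : α → Finset α}
    (hsymm : ∀ u v, u ∈ N v → v ∈ N u) {k : ℕ} {v a b : α} {T : Finset α}
    (hT : T ∈ walkSupports N k v) (ha : a ∈ T) (hb : b ∈ N a) :
    insert b T ∈ walkSupports N (k + 2) v := by
  induction k generalizing v T with
  | zero =>
    rw [walkSupports, Finset.mem_singleton] at hT
    subst hT
    rw [Finset.mem_singleton] at ha
    subst ha
    have h := mem_walkSupports_succ hb (mem_walkSupports_succ (k := 0) (hsymm _ _ hb)
      (by simp [walkSupports] : {a} ∈ walkSupports N 0 a))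
    rwa [Finset.insert_eq_of_mem (by simp)] at h
  | succ k ih =>
    rw [walkSupports, Finset.mem_biUnion] at hT
    obtain ⟨u, hu, hT⟩ := hT
    obtain ⟨T', hT', rfl⟩ := Finset.mem_image.1 hT
    by_cases haT : a ∈ T'
    · rw [Finset.insert_comm]
      exact mem_walkSupports_succ hu (ih hT' haT)
    · obtain rfl : a = v := by simpa [haT] using ha
      have h := mem_walkSupports_succ hb (mem_walkSupports_succ (hsymm _ _ hb)
        (mem_walkSupports_succ hu hT'))
      rwa [Finset.insert_eq_of_mem (by simp)] at h

/-- The set is grown one point at a time from `v`; linkedness supplies a new point next to the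
visited ones, and each point costs one detour. -/
theorem Linked.mem_walkSupports {α : Type*} [DecidableEq α] {N : α → Finset α}
    (hsymm : ∀ u v, u ∈ N v → v ∈ N u) {S : Finset α} (hS : Linked (fun x y => y ∈ N x) S)
    {v : α} (hv : v ∈ S) : S ∈ walkSupports N (2 * (S.card - 1)) v := by
  have key : ∀ m, 1 ≤ m → m ≤ S.card →
      ∃ T ⊆ S, T.card = m ∧ v ∈ T ∧ T ∈ walkSupports N (2 * (m - 1)) v := by
    intro m hm
    induction m, hm using Nat.le_induction with
    | base => exact fun _ => ⟨{v}, by simpa using hv, by simp, by simp, by simp [walkSupports]⟩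
    | succ m hm ih =>
      intro hmS
      obtain ⟨T, hTS, hTm, hvT, hTW⟩ := ih (by omega)
      have hne : T ≠ S := fun h => by rw [h] at hTm; omega
      have hnot : ¬∀ x ∈ T, ∀ y ∈ S \ T, ¬y ∈ N x := fun h => hne (hS T hTS ⟨v, hvT⟩ h)
      push Not at hnot
      obtain ⟨a, ha, b, hb, hab⟩ := hnot
      rw [Finset.mem_sdiff] at hb
      refine ⟨insert b T, Finset.insert_subset hb.1 hTS, by
        rw [Finset.card_insert_of_notMem hb.2, hTm], Finset.mem_insert_of_mem hvT, ?_⟩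
      rw [show 2 * (m + 1 - 1) = 2 * (m - 1) + 2 by omega]
      exact insert_mem_walkSupports hsymm hTW ha hab
  obtain ⟨T, hTS, hTm, _, hTW⟩ := key S.card (Finset.card_pos.2 ⟨v, hv⟩) le_rfl
  rwa [Finset.eq_of_subset_of_card_le hTS hTm.ge] at hTW

/-- The edges near a given one. -/
noncomputable def nearFinset {d : ℕ} (e : (Fin d → ℤ) × Fin d) : Finset ((Fin d → ℤ) × Fin d) :=
  (Fintype.piFinset fun k => Finset.Icc (e.1 k - 1) (e.1 k + 1)) ×ˢ Finset.univ

theorem mem_nearFinset {d : ℕ} {e e' : (Fin d → ℤ) × Fin d} :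
    e' ∈ nearFinset e ↔ Near e e' := by
  simp only [nearFinset, Finset.mem_product, Fintype.mem_piFinset, Finset.mem_Icc,
    Finset.mem_univ, and_true, Near, abs_le]
  exact forall_congr' fun k => by omega

theorem card_nearFinset {d : ℕ} (e : (Fin d → ℤ) × Fin d) : (nearFinset e).card = 3 ^ d * d := by
  simp only [nearFinset, Finset.card_product, Fintype.card_piFinset, Int.card_Icc,
    Finset.card_univ, Fintype.card_fin]
  congr 1
  rw [Finset.prod_congr rfl fun k _ => (by omega : (e.1 k + 1 + 1 - (e.1 k - 1)).toNat = 3)]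
  simp

theorem boxBoundary_mem_walkSupports {d n : ℕ} {E : Finset (Fin d → ℤ)}
    (h : Linked Near (boxBoundary n E)) {e : (Fin d → ℤ) × Fin d} (he : e ∈ boxBoundary n E) :
    boxBoundary n E ∈ walkSupports nearFinset (2 * ((boxBoundary n E).card - 1)) e := by
  refine Linked.mem_walkSupports (fun u v huv => ?_) ?_ he
  · rw [mem_nearFinset] at *
    exact huv.symm
  · simpa only [mem_nearFinset] using h

/-! ### Cheeger's inequality on weighted finite graphs -/

/-- Co-area inequality: if every nonempty superlevel set has cut at least `r` times its size, then
the total variation is at least `2 r` times the sum. -/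
theorem coarea {X : Type*} [Fintype X] [DecidableEq X] {w : X → X → ℝ}
    (hsymm : ∀ x y, w x y = w y x) {r : ℝ} {A₀ : Finset X}
    (hcut : ∀ A : Finset X, A ⊆ A₀ → A.Nonempty → r * A.card ≤ ∑ x ∈ A, ∑ y ∈ Aᶜ, w x y)
    (h : X → ℝ) (h0 : ∀ x, 0 ≤ h x) (hsupp : ∀ x, h x ≠ 0 → x ∈ A₀) :
    2 * r * ∑ x, h x ≤ ∑ x, ∑ y, w x y * |h x - h y| := by
  have key : ∀ m : ℕ, ∀ h : X → ℝ, (∀ x, 0 ≤ h x) → (∀ x, h x ≠ 0 → x ∈ A₀) →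
      (Finset.univ.filter fun x => h x ≠ 0).card = m →
      2 * r * ∑ x, h x ≤ ∑ x, ∑ y, w x y * |h x - h y| := by
    intro m
    induction m using Nat.strong_induction_on with
    | _ m ih =>
      intro h h0 hsupp hm
      rcases (Finset.univ.filter fun x => h x ≠ 0).eq_empty_or_nonempty with he | hne
      · have hz : ∀ x, h x = 0 := fun x => by
          by_contra hx
          exact Finset.notMem_empty x (he ▸ Finset.mem_filter.2 ⟨Finset.mem_univ x, hx⟩)
        simp [hz]
      · set S := Finset.univ.filter fun x => h x ≠ 0 with hS
        -- Subtracting the least positive value `t` on the support `S` shrinks the support. The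
        -- total variation drops by `2 * t` times the cut of `S`, each edge being counted in both
        -- orders.
        obtain ⟨z, hz, hzmin⟩ := S.exists_min_image h hne
        set t := h z with ht
        have hmemS : ∀ x, x ∈ S ↔ h x ≠ 0 := fun x => by simp [hS]
        have htpos : 0 < t := lt_of_le_of_ne (h0 z) (Ne.symm ((hmemS z).1 hz))
        let h' : X → ℝ := fun x => if x ∈ S then h x - t else 0
        have hh' : ∀ x, h x = h' x + t * if x ∈ S then 1 else 0 := by
          intro x
          by_cases hx : x ∈ S
          · simp [h', hx]
          · have : h x = 0 := by by_contra hc; exact hx ((hmemS x).2 hc)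
            simp [h', hx, this]
        have h'0 : ∀ x, 0 ≤ h' x := by
          intro x
          by_cases hx : x ∈ S
          · simp only [h', if_pos hx]; linarith [hzmin x hx]
          · simp [h', hx]
        have h'S : ∀ x, h' x ≠ 0 → x ∈ S := by
          intro x hx
          by_contra hc
          exact hx (by simp [h', hc])
        have hlt : (Finset.univ.filter fun x => h' x ≠ 0).card < m := by
          rw [← hm]
          refine Finset.card_lt_card ⟨fun x hx => h'S x (Finset.mem_filter.1 hx).2, fun hsub => ?_⟩
          have := (Finset.mem_filter.1 (hsub hz)).2
          simp [h', hz, ht] at this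
        have hrec := ih _ hlt h' h'0 (fun x hx => hsupp x ((hmemS x).1 (h'S x hx))) rfl
        have habs : ∀ x y, |h x - h y| = |h' x - h' y| +
            t * ((if x ∈ S ∧ y ∉ S then 1 else 0) + if y ∈ S ∧ x ∉ S then 1 else 0) := by
          intro x y
          by_cases hx : x ∈ S <;> by_cases hy : y ∈ S
          · rw [hh' x, hh' y]; simp [hx, hy]
          · have e : h' y = 0 := by simp [h', hy]
            rw [hh' x, hh' y]
            simp only [hx, hy, e, if_true, if_false]
            simp
            rw [abs_of_nonneg (h'0 x), abs_of_nonneg (by linarith [h'0 x])]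
          · have e : h' x = 0 := by simp [h', hx]
            rw [hh' x, hh' y]
            simp only [hx, hy, e, if_true, if_false]
            simp
            rw [abs_of_nonneg (h'0 y), show -t + -h' y = -(h' y + t) by ring, abs_neg,
              abs_of_nonneg (by linarith [h'0 y])]
          · rw [hh' x, hh' y]; simp [hx, hy]
        have hc1 : ∑ x, ∑ y, w x y * (if x ∈ S ∧ y ∉ S then (1 : ℝ) else 0) =
            ∑ x ∈ S, ∑ y ∈ Sᶜ, w x y := by
          rw [← Finset.sum_filter_add_sum_filter_not Finset.univ (fun x => x ∈ S)]
          have e1 : ∑ x with x ∉ S, ∑ y, w x y * (if x ∈ S ∧ y ∉ S then (1 : ℝ) else 0) = 0 :=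
            Finset.sum_eq_zero fun x hx => by simp [(Finset.mem_filter.1 hx).2]
          rw [e1, add_zero]
          have e2 : Finset.univ.filter (fun x => x ∈ S) = S := by ext; simp
          rw [e2]
          refine Finset.sum_congr rfl fun x hx => ?_
          simp only [hx, true_and, mul_ite, mul_one, mul_zero]
          rw [← Finset.sum_filter]
          congr 1
          ext; simp
        have hc2 : ∑ x, ∑ y, w x y * (if y ∈ S ∧ x ∉ S then (1 : ℝ) else 0) =
            ∑ x ∈ S, ∑ y ∈ Sᶜ, w x y := by
          rw [Finset.sum_comm, ← hc1]
          exact Finset.sum_congr rfl fun x _ => Finset.sum_congr rfl fun y _ => by rw [hsymm]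
        have hsumh : ∑ x, h x = ∑ x, h' x + t * S.card := by
          rw [Finset.sum_congr rfl fun x _ => hh' x, Finset.sum_add_distrib, ← Finset.mul_sum]
          simp
        have hsumw : ∑ x, ∑ y, w x y * |h x - h y| = ∑ x, ∑ y, w x y * |h' x - h' y| +
            2 * t * ∑ x ∈ S, ∑ y ∈ Sᶜ, w x y := by
          have : 2 * t * ∑ x ∈ S, ∑ y ∈ Sᶜ, w x y = t * (∑ x ∈ S, ∑ y ∈ Sᶜ, w x y) +
              t * (∑ x ∈ S, ∑ y ∈ Sᶜ, w x y) := by ring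
          rw [this]
          nth_rewrite 1 [← hc1]
          rw [← hc2]
          simp only [Finset.mul_sum, ← Finset.sum_add_distrib]
          refine Finset.sum_congr rfl fun x _ => Finset.sum_congr rfl fun y _ => ?_
          rw [habs]; ring
        have hcS := hcut S (fun x hx => hsupp x ((hmemS x).1 hx)) hne
        have := mul_le_mul_of_nonneg_left hcS (by linarith : (0 : ℝ) ≤ 2 * t)
        rw [hsumh, hsumw]
        linarith
  exact key _ h h0 hsupp rfl

/-- If every cut of a set of at most half the points exceeded `s` times its size, co-area for the
square of the positive part `g` of `f`, followed by Cauchy–Schwarz, would give `s ^ 2 ≤ 2 * D * μ`.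
-/
theorem cheeger_of_card_pos_le {X : Type*} [Fintype X] [DecidableEq X] {w : X → X → ℝ}
    (hsymm : ∀ x y, w x y = w y x) (hw : ∀ x y, 0 ≤ w x y) {D : ℝ} (hD : ∀ x, ∑ y, w x y ≤ D)
    {f : X → ℝ} {μ : ℝ} (hf : ∀ x, ∑ y, w x y * (f x - f y) = μ * f x)
    (hpos : ∃ x, 0 < f x)
    (hcard : 2 * (Finset.univ.filter fun x => 0 < f x).card ≤ Fintype.card X) {s : ℝ}
    (hs : 0 ≤ s) (hsμ : 2 * D * μ < s ^ 2) :
    ∃ A : Finset X, A.Nonempty ∧ 2 * A.card ≤ Fintype.card X ∧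
      ∑ x ∈ A, ∑ y ∈ Aᶜ, w x y ≤ s * A.card := by
  by_contra! hcon
  let g : X → ℝ := fun x => max (f x) 0
  have hg0 : ∀ x, 0 ≤ g x := fun x => le_max_right _ _
  have hgsupp : ∀ x, g x ≠ 0 → 0 < f x := by
    intro x hx
    by_contra! hc
    exact hx (max_eq_right hc)
  have hco := coarea hsymm (r := s) (A₀ := Finset.univ.filter fun x => 0 < f x)
    (fun A hA hne => (hcon A hne (by have := Finset.card_le_card hA; omega)).le)
    (fun x => g x ^ 2) (fun x => sq_nonneg _) (fun x hx => by
      simpa using hgsupp x (fun h => hx (by simp [h])))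
  set G := ∑ x, g x ^ 2 with hG
  have hGpos : 0 < G := by
    obtain ⟨x, hx⟩ := hpos
    refine Finset.sum_pos' (fun x _ => sq_nonneg _) ⟨x, Finset.mem_univ x, ?_⟩
    have : 0 < g x := lt_of_lt_of_le hx (le_max_left _ _)
    positivity
  -- the energy of the positive part
  have hQ : ∑ x, ∑ y, w x y * (g x - g y) ^ 2 ≤ 2 * μ * G := by
    have e1 : ∑ x, ∑ y, w x y * (g x - g y) ^ 2 = 2 * ∑ x, ∑ y, w x y * (g x * (g x - g y)) := by
      have e2 : ∑ x, ∑ y, w x y * (g x * (g x - g y)) = ∑ x, ∑ y, w x y * (g y * (g y - g x)) := by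
        rw [Finset.sum_comm]
        exact Finset.sum_congr rfl fun x _ => Finset.sum_congr rfl fun y _ => by rw [hsymm]
      rw [two_mul]
      nth_rewrite 2 [e2]
      simp only [← Finset.sum_add_distrib]
      exact Finset.sum_congr rfl fun x _ => Finset.sum_congr rfl fun y _ => by ring
    -- Where `g` is positive it equals `f`, and elsewhere `g` dominates `f`, so truncation only
    -- lowers the differences `g x - g y`.
    have e3 : ∑ x, ∑ y, w x y * (g x * (g x - g y)) ≤ ∑ x, μ * g x ^ 2 := by
      refine Finset.sum_le_sum fun x _ => ?_
      by_cases hx : g x = 0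
      · simp [hx]
      · have hgx : g x = f x := max_eq_left (hgsupp x hx).le
        calc ∑ y, w x y * (g x * (g x - g y)) ≤ ∑ y, g x * (w x y * (f x - f y)) := by
              refine Finset.sum_le_sum fun y _ => ?_
              have : f y ≤ g y := le_max_left _ _
              have h1 := mul_nonneg (mul_nonneg (hw x y) (hg0 x)) (sub_nonneg.2 this)
              rw [hgx] at h1 ⊢
              linarith
          _ = μ * g x ^ 2 := by rw [← Finset.mul_sum, hf x, hgx]; ring
    rw [← Finset.mul_sum] at e3
    linarith
  have hP : ∑ x, ∑ y, w x y * (g x + g y) ^ 2 ≤ 4 * D * G := by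
    have e1 : ∑ x, ∑ y, w x y * g x ^ 2 ≤ D * G := by
      rw [hG, Finset.mul_sum]
      refine Finset.sum_le_sum fun x _ => ?_
      rw [← Finset.sum_mul]
      exact mul_le_mul_of_nonneg_right (hD x) (sq_nonneg _)
    have e2 : ∑ x, ∑ y, w x y * g y ^ 2 = ∑ x, ∑ y, w x y * g x ^ 2 := by
      rw [Finset.sum_comm]
      exact Finset.sum_congr rfl fun x _ => Finset.sum_congr rfl fun y _ => by rw [hsymm]
    have e3 : ∑ x, ∑ y, w x y * (g x + g y) ^ 2 ≤
        ∑ x, ∑ y, (2 * (w x y * g x ^ 2) + 2 * (w x y * g y ^ 2)) := by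
      refine Finset.sum_le_sum fun x _ => Finset.sum_le_sum fun y _ => ?_
      have := mul_nonneg (hw x y) (sq_nonneg (g x - g y))
      linarith
    simp only [Finset.sum_add_distrib, ← Finset.mul_sum] at e3
    linarith
  have hCS : (∑ x, ∑ y, w x y * |g x ^ 2 - g y ^ 2|) ^ 2 ≤
      (∑ x, ∑ y, w x y * (g x - g y) ^ 2) * ∑ x, ∑ y, w x y * (g x + g y) ^ 2 := by
    simp only [← Finset.sum_product']
    refine Finset.sum_sq_le_sum_mul_sum_of_sq_le_mul _ (fun p _ => mul_nonneg (hw _ _) (sq_nonneg _))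
      (fun p _ => mul_nonneg (hw _ _) (sq_nonneg _)) (fun p _ => ?_)
    rw [mul_pow, sq_abs]
    exact le_of_eq (by ring)
  have hQ0 : 0 ≤ ∑ x, ∑ y, w x y * (g x - g y) ^ 2 :=
    Finset.sum_nonneg fun x _ => Finset.sum_nonneg fun y _ => mul_nonneg (hw _ _) (sq_nonneg _)
  have hP0 : 0 ≤ ∑ x, ∑ y, w x y * (g x + g y) ^ 2 :=
    Finset.sum_nonneg fun x _ => Finset.sum_nonneg fun y _ => mul_nonneg (hw _ _) (sq_nonneg _)
  have h1 : (2 * s * G) ^ 2 ≤ (2 * μ * G) * (4 * D * G) :=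
    (pow_le_pow_left₀ (by positivity) hco 2).trans
      (hCS.trans (mul_le_mul hQ hP hP0 (hQ0.trans hQ)))
  have h2 : s ^ 2 * G ^ 2 ≤ (2 * D * μ) * G ^ 2 := by linarith
  exact absurd (le_of_mul_le_mul_right h2 (by positivity)) (not_le.2 hsμ)

/-- Cheeger's inequality for weighted finite graphs. -/
theorem cheeger {X : Type*} [Fintype X] [DecidableEq X] {w : X → X → ℝ}
    (hsymm : ∀ x y, w x y = w y x) (hw : ∀ x y, 0 ≤ w x y) {D : ℝ} (hD : ∀ x, ∑ y, w x y ≤ D)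
    {f : X → ℝ} {μ : ℝ} (hf : ∀ x, ∑ y, w x y * (f x - f y) = μ * f x) (hμ : μ ≠ 0) (hf0 : f ≠ 0)
    {s : ℝ} (hs : 0 ≤ s) (hsμ : 2 * D * μ < s ^ 2) :
    ∃ A : Finset X, A.Nonempty ∧ 2 * A.card ≤ Fintype.card X ∧
      ∑ x ∈ A, ∑ y ∈ Aᶜ, w x y ≤ s * A.card := by
  -- An eigenfunction for a nonzero eigenvalue has mean zero, so it takes both signs, and `f` or
  -- `-f` is positive on at most half of the points.
  have hsum : ∑ x, f x = 0 := by
    have e1 : ∑ x, ∑ y, w x y * (f x - f y) = 0 := by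
      have e2 : ∑ x, ∑ y, w x y * (f x - f y) = ∑ x, ∑ y, -(w x y * (f x - f y)) := by
        rw [Finset.sum_comm]
        exact Finset.sum_congr rfl fun x _ => Finset.sum_congr rfl fun y _ => by
          rw [hsymm]; ring
      simp only [Finset.sum_neg_distrib] at e2
      linarith
    rw [Finset.sum_congr rfl fun x _ => hf x, ← Finset.mul_sum] at e1
    exact (mul_eq_zero.1 e1).resolve_left hμ
  obtain ⟨z, hz⟩ := Function.ne_iff.1 hf0
  have hpos : ∃ x, 0 < f x := by
    by_contra! hc
    exact hz ((Finset.sum_eq_zero_iff_of_nonpos fun x _ => hc x).1 hsum z (Finset.mem_univ z))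
  have hneg : ∃ x, 0 < -f x := by
    by_contra! hc
    exact hz ((Finset.sum_eq_zero_iff_of_nonneg fun x _ => by linarith [hc x]).1 hsum z
      (Finset.mem_univ z))
  have hdis : Disjoint (Finset.univ.filter fun x => 0 < f x)
      (Finset.univ.filter fun x => 0 < -f x) := by
    rw [Finset.disjoint_filter]
    intro x _ h h'
    linarith
  have hle := Finset.card_le_univ ((Finset.univ.filter fun x => 0 < f x) ∪
    (Finset.univ.filter fun x => 0 < -f x))
  rw [Finset.card_union_of_disjoint hdis] at hle
  by_cases hc : 2 * (Finset.univ.filter fun x => 0 < f x).card ≤ Fintype.card X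
  · exact cheeger_of_card_pos_le hsymm hw hD hf hpos hc hs hsμ
  · refine cheeger_of_card_pos_le hsymm hw hD (f := fun x => -f x) (fun x => ?_) hneg (by omega)
      hs hsμ
    rw [mul_neg, ← hf x, ← Finset.sum_neg_distrib]
    exact Finset.sum_congr rfl fun y _ => by ring

/-! ### Lattice bonds and the Peierls estimate -/

theorem latticeGraph_adj_unitVec {d : ℕ} (x : Fin d → ℤ) (i : Fin d) :
    (latticeGraph d).Adj x (x + unitVec i) := by
  change ∑ j, |x j - (x + unitVec i) j| = 1
  rw [Finset.sum_eq_single i]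
  · simp [unitVec_apply]
  · intro j _ hj
    simp [unitVec_apply, hj]
  · simp

theorem neighbour_of_latticeGraph_adj {d : ℕ} {x y : Fin d → ℤ} (h : (latticeGraph d).Adj x y) :
    Neighbour x y := by
  change ∑ j, |x j - y j| = 1 at h
  obtain ⟨i, hi⟩ : ∃ i, x i ≠ y i := by
    by_contra! hc
    simp [hc] at h
  rw [← Finset.add_sum_erase _ _ (Finset.mem_univ i)] at h
  have h1 : 1 ≤ |x i - y i| := Int.one_le_abs (sub_ne_zero.2 hi)
  have h2 : 0 ≤ ∑ j ∈ Finset.univ.erase i, |x j - y j| :=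
    Finset.sum_nonneg fun _ _ => abs_nonneg _
  have h3 : ∀ j, j ≠ i → x j = y j := by
    intro j hj
    have := (Finset.sum_eq_zero_iff_of_nonneg fun j _ => abs_nonneg (x j - y j)).1
      (by omega : ∑ j ∈ Finset.univ.erase i, |x j - y j| = 0) j (by simp [hj])
    exact sub_eq_zero.1 (abs_eq_zero.1 this)
  have h4 : |x i - y i| = 1 := by omega
  refine ⟨i, ?_⟩
  rcases (abs_eq zero_le_one).1 h4 with h5 | h5
  · right
    ext j
    by_cases hj : j = i
    · subst hj; simp [unitVec_apply]; omega
    · simp [unitVec_apply, hj, h3 j hj]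
  · left
    ext j
    by_cases hj : j = i
    · subst hj; simp [unitVec_apply]; omega
    · simp [unitVec_apply, hj, h3 j hj]

/-- The lattice edge `{x, x + eᵢ}`. -/
def bond {d : ℕ} (e : (Fin d → ℤ) × Fin d) : (latticeGraph d).edgeSet :=
  ⟨s(e.1, e.1 + unitVec e.2), latticeGraph_adj_unitVec e.1 e.2⟩

theorem eq_of_sym2_unitVec {d : ℕ} {x y : Fin d → ℤ} {i j : Fin d}
    (h : s(x, x + unitVec i) = s(y, y + unitVec j)) : x = y ∧ i = j := by
  have hpos : ∀ k : Fin d, ∑ l, (unitVec k : Fin d → ℤ) l = 1 := fun k => by simp [unitVec_apply]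
  rcases Sym2.eq_iff.1 h with ⟨rfl, h2⟩ | ⟨h1, h2⟩
  · refine ⟨rfl, ?_⟩
    have := congrFun (add_left_cancel h2) i
    simp only [unitVec_apply, if_true] at this
    by_contra hc
    simp [hc] at this
  · have e1 := congrArg (fun z : Fin d → ℤ => ∑ l, z l) h1
    have e2 := congrArg (fun z : Fin d → ℤ => ∑ l, z l) h2
    simp only [Pi.add_apply, Finset.sum_add_distrib, hpos] at e1 e2
    omega

theorem bond_injective {d : ℕ} : Function.Injective (bond (d := d)) := by
  rintro ⟨x, i⟩ ⟨y, j⟩ h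
  obtain ⟨h1, h2⟩ := eq_of_sym2_unitVec (Subtype.ext_iff.1 h)
  exact Prod.ext h1 h2

instance isProbabilityMeasure_bondMeasure (d : ℕ) (p : I) :
    IsProbabilityMeasure (bondMeasure d p) := by
  unfold bondMeasure
  infer_instance

theorem bondMeasure_closed {d : ℕ} (p : I) (S : Finset ((Fin d → ℤ) × Fin d)) :
    (bondMeasure d p).real {ω | ∀ e ∈ S, ω (bond e) = false} = (1 - (p : ℝ)) ^ S.card := by
  have hset : {ω : Config d | ∀ e ∈ S, ω (bond e) = false} =
      Set.pi (S.map ⟨bond, bond_injective⟩ : Finset _) fun _ => {false} := by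
    ext ω
    simp only [Set.mem_pi, Finset.mem_coe, Finset.forall_mem_map, Set.mem_singleton_iff]
    rfl
  rw [hset, bondMeasure, measureReal_def, Measure.infinitePi_pi _ fun _ _ => by measurability]
  rw [Finset.prod_const, Finset.card_map, ENNReal.toReal_pow, ← measureReal_def,
    bernoulliMeasure_real_apply _ (by measurability)]
  simp

-- Union bound over the at most `2 ^ S.card` possible sets of closed edges with at least half the
-- elements of `S`.
open Classical in
theorem bondMeasure_half_closed_le {d : ℕ} (p : I) (S : Finset ((Fin d → ℤ) × Fin d)) :
    (bondMeasure d p).real {ω | 2 * (S.filter fun e => ω (bond e) = true).card ≤ S.card} ≤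
      (2 * Real.sqrt (1 - p)) ^ S.card := by
  have hp0 : (0 : ℝ) ≤ 1 - p := sub_nonneg.2 p.2.2
  have hs1 : Real.sqrt (1 - p) ≤ 1 := Real.sqrt_le_one.2 (by linarith [p.2.1])
  have hsub : {ω : Config d | 2 * (S.filter fun e => ω (bond e) = true).card ≤ S.card} ⊆
      ⋃ T ∈ S.powerset.filter fun T => S.card ≤ 2 * T.card,
        {ω : Config d | ∀ e ∈ T, ω (bond e) = false} := by
    intro ω hω
    change 2 * (S.filter fun e => ω (bond e) = true).card ≤ S.card at hω
    simp only [Set.mem_iUnion]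
    refine ⟨S.filter fun e => ¬ω (bond e) = true, ?_, ?_⟩
    · rw [Finset.mem_filter, Finset.mem_powerset]
      have := Finset.card_filter_add_card_filter_not (s := S) (fun e => ω (bond e) = true)
      exact ⟨Finset.filter_subset _ _, by omega⟩
    · intro e he
      simpa using (Finset.mem_filter.1 he).2
  refine (measureReal_mono hsub (measure_ne_top _ _)).trans ((measureReal_biUnion_finset_le _ _).trans ?_)
  calc ∑ T ∈ S.powerset.filter fun T => S.card ≤ 2 * T.card,
        (bondMeasure d p).real {ω | ∀ e ∈ T, ω (bond e) = false}
      ≤ ∑ T ∈ S.powerset.filter fun T => S.card ≤ 2 * T.card, Real.sqrt (1 - p) ^ S.card := by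
        refine Finset.sum_le_sum fun T hT => ?_
        rw [bondMeasure_closed]
        nth_rewrite 1 [← Real.sq_sqrt hp0]
        rw [← pow_mul]
        exact pow_le_pow_of_le_one (Real.sqrt_nonneg _) hs1 (Finset.mem_filter.1 hT).2
    _ ≤ ∑ T ∈ S.powerset, Real.sqrt (1 - p) ^ S.card :=
        Finset.sum_le_sum_of_subset_of_nonneg (Finset.filter_subset _ _) fun _ _ _ => by positivity
    _ = _ := by
        rw [Finset.sum_const, Finset.card_powerset, mul_pow, nsmul_eq_mul]
        push_cast
        rfl

open Classical in
/-- Peierls estimate: long linked boundaries with at least half of their edges closed are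
unlikely. -/
theorem peierls {d : ℕ} (hd : 2 ≤ d) {p : I}
    (hp : 12 * ((3 : ℝ) ^ d * d) ^ 2 * Real.sqrt (1 - p) ≤ 1) (n : ℕ) (t : ℝ) :
    (bondMeasure d p).real {ω | ∃ E : Finset (Fin d → ℤ), Linked Near (boxBoundary n E) ∧
      (boxBoundary n E).Nonempty ∧ t ≤ (boxBoundary n E).card ∧
      2 * ((boxBoundary n E).filter fun e => ω (bond e) = true).card ≤ (boxBoundary n E).card} ≤
      2 * ((2 * n + 1) ^ d * d) * Real.exp (-t) := by
  set s := Real.sqrt (1 - p) with hs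
  have hs0 : 0 ≤ s := Real.sqrt_nonneg _
  set K : ℝ := (3 : ℝ) ^ d * d with hK
  have hK1 : 1 ≤ K := by
    have h1 : (1 : ℝ) ≤ 3 ^ d := one_le_pow₀ (by norm_num)
    have h2 : (1 : ℝ) ≤ d := by exact_mod_cast (by omega : 1 ≤ d)
    exact one_le_mul_of_one_le_of_one_le h1 h2
  set B : Finset ((Fin d → ℤ) × Fin d) := boxFinset d n ×ˢ Finset.univ with hB
  have hBcard : (B.card : ℝ) = (2 * n + 1) ^ d * d := by
    rw [hB, Finset.card_product, card_boxFinset]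
    simp
  have hsub : {ω : Config d | ∃ E : Finset (Fin d → ℤ), Linked Near (boxBoundary n E) ∧
      (boxBoundary n E).Nonempty ∧ t ≤ (boxBoundary n E).card ∧
      2 * ((boxBoundary n E).filter fun e => ω (bond e) = true).card ≤ (boxBoundary n E).card} ⊆
      ⋃ e ∈ B, ⋃ m ∈ (Finset.range (B.card + 1)).filter fun m : ℕ => 1 ≤ m ∧ t ≤ (m : ℝ),
        ⋃ S ∈ (walkSupports nearFinset (2 * (m - 1)) e).filter fun S => S.card = m,
          {ω : Config d | 2 * (S.filter fun e => ω (bond e) = true).card ≤ S.card} := by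
    rintro ω ⟨E, hl, ⟨e, he⟩, ht, hω⟩
    simp only [Set.mem_iUnion]
    refine ⟨e, Finset.filter_subset _ _ he, (boxBoundary n E).card, ?_, boxBoundary n E, ?_, hω⟩
    · rw [Finset.mem_filter, Finset.mem_range, Nat.lt_succ_iff]
      exact ⟨Finset.card_le_card (Finset.filter_subset _ _), Finset.card_pos.2 ⟨e, he⟩, ht⟩
    · exact Finset.mem_filter.2 ⟨boxBoundary_mem_walkSupports hl he, rfl⟩
  have hterm : ∀ e, ∀ m ∈ (Finset.range (B.card + 1)).filter fun m : ℕ => 1 ≤ m ∧ t ≤ (m : ℝ),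
      (bondMeasure d p).real
        (⋃ S ∈ (walkSupports nearFinset (2 * (m - 1)) e).filter fun S => S.card = m,
          {ω : Config d | 2 * (S.filter fun e => ω (bond e) = true).card ≤ S.card}) ≤
        (1 / 2) ^ m * Real.exp (-t) := by
    intro e m hm
    obtain ⟨-, hm1, hmt⟩ := Finset.mem_filter.1 hm
    refine (measureReal_biUnion_finset_le _ _).trans ?_
    calc _ ≤ ∑ S ∈ (walkSupports nearFinset (2 * (m - 1)) e).filter fun S => S.card = m,
            (2 * s) ^ m := by
          refine Finset.sum_le_sum fun S hS => ?_
          have := bondMeasure_half_closed_le p S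
          rwa [(Finset.mem_filter.1 hS).2] at this ⊢
      _ ≤ K ^ (2 * m) * (2 * s) ^ m := by
          rw [Finset.sum_const, nsmul_eq_mul]
          refine mul_le_mul_of_nonneg_right ?_ (by positivity)
          have h1 := (Finset.card_filter_le _ fun S => S.card = m).trans
            (card_walkSupports_le (fun v => (card_nearFinset (d := d) v).le) (2 * (m - 1)) e)
          calc (_ : ℝ) ≤ ((3 ^ d * d) ^ (2 * (m - 1)) : ℕ) := by exact_mod_cast h1
            _ = K ^ (2 * (m - 1)) := by rw [hK]; push_cast; rfl
            _ ≤ K ^ (2 * m) := pow_le_pow_right₀ hK1 (by omega)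
      _ = (2 * K ^ 2 * s) ^ m := by rw [pow_mul, ← mul_pow]; ring
      _ ≤ (1 / 6) ^ m := pow_le_pow_left₀ (by positivity) (by linarith) m
      -- One factor makes the sum over `m` converge; the other, being at most `exp (-m)`, yields
      -- `exp (-t)`.
      _ = (1 / 2) ^ m * (1 / 3) ^ m := by rw [← mul_pow]; norm_num
      _ ≤ (1 / 2) ^ m * Real.exp (-t) := by
          refine mul_le_mul_of_nonneg_left ?_ (by positivity)
          calc ((1 / 3 : ℝ)) ^ m ≤ Real.exp (-1) ^ m := by
                refine pow_le_pow_left₀ (by norm_num) ?_ m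
                rw [Real.exp_neg, one_div]
                exact inv_anti₀ (Real.exp_pos _) Real.exp_one_lt_three.le
            _ = Real.exp (-(m : ℝ)) := by rw [← Real.exp_nat_mul]; congr 1; ring
            _ ≤ Real.exp (-t) := Real.exp_le_exp.2 (by linarith)
  refine (measureReal_mono hsub (measure_ne_top _ _)).trans ((measureReal_biUnion_finset_le _ _).trans ?_)
  calc _ ≤ ∑ e ∈ B, 2 * Real.exp (-t) := by
        refine Finset.sum_le_sum fun e _ => (measureReal_biUnion_finset_le _ _).trans
          ((Finset.sum_le_sum (hterm e)).trans ?_)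
        rw [← Finset.sum_mul]
        refine mul_le_mul_of_nonneg_right ?_ (Real.exp_pos _).le
        refine (Summable.sum_le_tsum _ (fun _ _ => by positivity) summable_geometric_two).trans ?_
        exact tsum_geometric_two.le
    _ = _ := by rw [Finset.sum_const, nsmul_eq_mul, hBcard]; ring

/-! ### From small cuts to long, half-closed boundaries -/

/-- The cluster has a nonempty part of at most half its size with at most `r` boundary edges per
vertex. -/
def HasSmallCut {d : ℕ} (n : ℕ) (r : ℝ) (ω : Config d) : Prop :=
  ∃ A : Finset (Fin d → ℤ), A.Nonempty ∧ (A : Set (Fin d → ℤ)) ⊆ boxCluster ω n ∧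
    2 * A.card ≤ (boxCluster ω n).ncard ∧ ((edgeBoundary ω n A).ncard : ℝ) ≤ r * A.card

theorem HasSmallCut.mono {d n : ℕ} {r r' : ℝ} (hr : r ≤ r') {ω : Config d}
    (h : HasSmallCut n r ω) : HasSmallCut n r' ω := by
  obtain ⟨A, h1, h2, h3, h4⟩ := h
  exact ⟨A, h1, h2, h3, h4.trans (mul_le_mul_of_nonneg_right hr (by positivity))⟩

theorem hasSmallCut_of_cheegerConstant_lt {d n : ℕ} {r : ℝ} {ω : Config d}
    (h : cheegerConstant ω n < (r : EReal)) : HasSmallCut n r ω := by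
  simp only [cheegerConstant, iInf_lt_iff] at h
  obtain ⟨A, hne, hsub, hcard, hlt⟩ := h
  have hfin : A.Finite := (Set.toFinite (boxCluster ω n)).subset hsub
  lift A to Finset (Fin d → ℤ) using hfin
  rw [Set.ncard_coe_finset] at hcard hlt
  have hpos : (0 : ℝ) < A.card := by exact_mod_cast Finset.card_pos.2 (by simpa using hne)
  rw [EReal.coe_lt_coe_iff, div_lt_iff₀ hpos] at hlt
  refine ⟨A, by simpa using hne, hsub, ?_, hlt.le⟩
  have : (2 * A.card : ℝ) ≤ (boxCluster ω n).ncard := by linarith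
  exact_mod_cast this

open Classical in
theorem card_neighbours_le {d : ℕ} {ω : Config d} {C : Set (Fin d → ℤ)} [Fintype C] (x : C) :
    (Finset.univ.filter fun y : C => (openGraph ω).Adj x y).card ≤ 2 * d := by
  have hsub : (Finset.univ.filter fun y : C => (openGraph ω).Adj x y).map
      (Function.Embedding.subtype _) ⊆
      (Finset.univ : Finset (Fin d)).image (fun i => (x : Fin d → ℤ) + unitVec i) ∪
      (Finset.univ : Finset (Fin d)).image (fun i => (x : Fin d → ℤ) - unitVec i) := by
    intro y hy
    obtain ⟨y, hy', rfl⟩ := Finset.mem_map.1 hy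
    obtain ⟨h, -⟩ := (Finset.mem_filter.1 hy').2
    simp only [Finset.mem_union, Finset.mem_image, Finset.mem_univ, true_and]
    obtain ⟨i, hi | hi⟩ := neighbour_of_latticeGraph_adj h
    · exact Or.inl ⟨i, hi.symm⟩
    · exact Or.inr ⟨i, by rw [hi]; simp⟩
  have h := (Finset.card_le_card hsub).trans (Finset.card_union_le _ _)
  have h1 := Finset.card_image_le (s := (Finset.univ : Finset (Fin d)))
    (f := fun i => (x : Fin d → ℤ) + unitVec i)
  have h2 := Finset.card_image_le (s := (Finset.univ : Finset (Fin d)))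
    (f := fun i => (x : Fin d → ℤ) - unitVec i)
  rw [Finset.card_map] at h
  simp only [Finset.card_univ, Fintype.card_fin] at h1 h2
  omega

open Classical in
theorem laplacian_apply {d : ℕ} (ω : Config d) (n : ℕ) [inst : Fintype (boxCluster ω n)]
    (f : boxCluster ω n → ℝ) (x : boxCluster ω n) :
    laplacian ω n f x = (1 / (2 * (d : ℝ))) *
      ∑ y : boxCluster ω n, (if (openGraph ω).Adj x y then 1 else 0) * (f x - f y) := by
  obtain rfl : inst = Fintype.ofFinite _ := Subsingleton.elim _ _
  let _ : Fintype (boxCluster ω n) := Fintype.ofFinite _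
  unfold laplacian
  rw [LinearMap.smul_apply, Pi.smul_apply, smul_eq_mul, Matrix.toLin'_apply,
    SimpleGraph.lapMatrix_mulVec_apply]
  congr 1
  rw [← SimpleGraph.card_neighborFinset_eq_degree, ← nsmul_eq_mul, ← Finset.sum_const,
    ← Finset.sum_sub_distrib, SimpleGraph.neighborFinset_eq_filter, Finset.sum_filter]
  simp only [ite_mul, one_mul, zero_mul]
  rfl

open Classical in
theorem hasSmallCut_of_spectralGap_lt {d n : ℕ} (hd : 2 ≤ d) {t s : ℝ} (hs : 0 ≤ s)
    (hst : 8 * (d : ℝ) ^ 2 * t ≤ s ^ 2) {ω : Config d}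
    (h : spectralGap ω n < (t : EReal)) : HasSmallCut n s ω := by
  let _ : Fintype (boxCluster ω n) := Fintype.ofFinite _
  simp only [spectralGap, iInf_lt_iff] at h
  obtain ⟨μ, hev, hμ, hlt⟩ := h
  rw [EReal.coe_lt_coe_iff] at hlt
  obtain ⟨f, hf⟩ := hev.exists_hasEigenvector
  have hd0 : (0 : ℝ) < d := by exact_mod_cast (by omega : 0 < d)
  have hfx : ∀ x : boxCluster ω n, ∑ y : boxCluster ω n,
      (if (openGraph ω).Adj x y then (1 : ℝ) else 0) * (f x - f y) = (2 * d * μ) * f x := by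
    intro x
    have h1 := congrFun hf.apply_eq_smul x
    rw [laplacian_apply, Pi.smul_apply, smul_eq_mul] at h1
    rw [mul_assoc, ← h1]
    field_simp
  -- Without the factor `1 / (2 * d)` the eigenvalue is `2 * d * μ` and degrees are at most `D = 2 *
  -- d`, whence the constant `8 * d ^ 2`.
  obtain ⟨A, hne, hcard, hcut⟩ := cheeger
    (w := fun x y : boxCluster ω n => if (openGraph ω).Adj x y then (1 : ℝ) else 0)
    (fun x y => by simp only [(openGraph ω).adj_comm]) (fun x y => by positivity)
    (D := 2 * d) (fun x => by
      rw [Finset.sum_boole]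
      exact_mod_cast card_neighbours_le x) hfx (by positivity) hf.2 hs (by
      have := mul_lt_mul_of_pos_left hlt (by positivity : (0 : ℝ) < 8 * d ^ 2)
      linarith)
  refine ⟨A.map (Function.Embedding.subtype _), hne.map, ?_, ?_, ?_⟩
  · intro x hx
    obtain ⟨y, -, rfl⟩ := Finset.mem_map.1 (Finset.mem_coe.1 hx)
    exact y.2
  · rw [Finset.card_map, ← Nat.card_coe_set_eq, Nat.card_eq_fintype_card]
    exact hcard
  · rw [Finset.card_map]
    refine le_trans ?_ hcut
    have hsub : edgeBoundary ω n (A.map (Function.Embedding.subtype _) : Finset (Fin d → ℤ)) ⊆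
        (((A ×ˢ Aᶜ).filter fun q => (openGraph ω).Adj q.1 q.2).image
          fun q => s((q.1 : Fin d → ℤ), (q.2 : Fin d → ℤ)) : Finset _) := by
      rintro e ⟨x, hx, y, hy, hadj, hxA, hyA, rfl⟩
      rw [Finset.mem_coe, Finset.mem_image]
      refine ⟨(⟨x, hx⟩, ⟨y, hy⟩), ?_, rfl⟩
      simp only [Finset.mem_coe, Finset.mem_map, Function.Embedding.subtype_apply,
        Subtype.exists, exists_and_right, exists_eq_right] at hxA hyA
      simp only [Finset.mem_filter, Finset.mem_product, Finset.mem_compl]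
      exact ⟨⟨hxA.2, fun h => hyA ⟨hy, h⟩⟩, hadj⟩
    have h1 := Set.ncard_le_ncard hsub (Finset.finite_toSet _)
    rw [Set.ncard_coe_finset] at h1
    have h2 := h1.trans Finset.card_image_le
    rw [← Finset.sum_product', Finset.sum_boole]
    exact_mod_cast h2

theorem mem_boxCluster_of_adj {d : ℕ} {ω : Config d} {n : ℕ} {x y : Fin d → ℤ}
    (hx : x ∈ boxCluster ω n) (hadj : (openGraph ω).Adj x y) (hy : y ∈ box d n) :
    y ∈ boxCluster ω n := by
  obtain ⟨w, hw⟩ := hx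
  refine ⟨w.concat hadj, fun z hz => ?_⟩
  rw [SimpleGraph.Walk.support_concat, List.mem_append] at hz
  rcases hz with hz | hz
  · exact hw z hz
  · rw [List.mem_singleton] at hz; rwa [hz]

theorem mem_boxFinset_iff {d n : ℕ} {x : Fin d → ℤ} : x ∈ boxFinset d n ↔ x ∈ box d n := by
  rw [mem_boxFinset]
  exact forall_congr' fun i => abs_le.symm

theorem openGraph_adj_unitVec {d : ℕ} {ω : Config d} {x : Fin d → ℤ} {i : Fin d} :
    (openGraph ω).Adj x (x + unitVec i) ↔ ω (bond (x, i)) = true :=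
  ⟨fun ⟨_, h⟩ => h, fun h => ⟨latticeGraph_adj_unitVec x i, h⟩⟩

/-- A set of vertices that splits the cluster has an open boundary edge. -/
theorem exists_open_boxBoundary {d n : ℕ} {ω : Config d} {E : Finset (Fin d → ℤ)}
    {x y : Fin d → ℤ} (hx : x ∈ boxCluster ω n) (hy : y ∈ boxCluster ω n) (hxE : x ∈ E)
    (hyE : y ∉ E) : ∃ e ∈ boxBoundary n E, ω (bond e) = true := by
  have key : ∀ (S : Set (Fin d → ℤ)) (z : Fin d → ℤ), 0 ∈ S → z ∉ S → z ∈ boxCluster ω n →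
      ∃ u v, u ∈ S ∧ v ∉ S ∧ u ∈ box d n ∧ v ∈ box d n ∧ (openGraph ω).Adj u v := by
    rintro S z h0 hz ⟨w, hw⟩
    obtain ⟨q, hq, h1, h2⟩ := w.exists_boundary_dart S h0 hz
    exact ⟨q.fst, q.snd, h1, h2, hw _ (w.dart_fst_mem_support_of_mem_darts hq),
      hw _ (w.dart_snd_mem_support_of_mem_darts hq), q.adj⟩
  obtain ⟨u, v, huv, hu, hv, hadj⟩ : ∃ u v, ¬(u ∈ E ↔ v ∈ E) ∧ u ∈ box d n ∧ v ∈ box d n ∧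
      (openGraph ω).Adj u v := by
    -- Whichever side contains the origin, the open walk from it to `x` or `y` on the other side
    -- crosses the boundary.
    by_cases h0 : (0 : Fin d → ℤ) ∈ E
    · obtain ⟨u, v, h1, h2, h3⟩ := key E y h0 hyE hy
      exact ⟨u, v, fun h => h2 (h.1 h1), h3⟩
    · obtain ⟨u, v, h1, h2, h3⟩ := key (E : Set (Fin d → ℤ))ᶜ x h0 (fun h => h hxE) hx
      exact ⟨u, v, fun h => h1 (h.2 (by simpa using h2)), h3⟩
  rw [← mem_boxFinset_iff] at hu hv
  obtain ⟨i, rfl | rfl⟩ := neighbour_of_latticeGraph_adj hadj.1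
  · exact ⟨(u, i), mem_boxBoundary.2 ⟨hu, hv, huv⟩, openGraph_adj_unitVec.1 hadj⟩
  · exact ⟨(v, i), mem_boxBoundary.2 ⟨hv, hu, fun h => huv h.symm⟩,
      openGraph_adj_unitVec.1 hadj.symm⟩

-- An open edge of the box with one end in the cluster has both ends there, and `bond` is injective,
-- so no edge is counted twice.
open Classical in
theorem card_open_boxBoundary_le {d n : ℕ} {ω : Config d} {A : Finset (Fin d → ℤ)}
    (hA : (A : Set (Fin d → ℤ)) ⊆ boxCluster ω n) :
    ((boxBoundary n A).filter fun e => ω (bond e) = true).card ≤ (edgeBoundary ω n A).ncard := by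
  have hinj : Function.Injective fun e : (Fin d → ℤ) × Fin d => s(e.1, e.1 + unitVec e.2) :=
    fun e e' h => bond_injective (Subtype.ext h)
  rw [← Finset.card_image_of_injective _ hinj, ← Set.ncard_coe_finset]
  refine Set.ncard_le_ncard ?_ ?_
  · intro s hs
    obtain ⟨⟨x, i⟩, he, rfl⟩ := Finset.mem_image.1 (Finset.mem_coe.1 hs)
    obtain ⟨hb, ho⟩ := Finset.mem_filter.1 he
    obtain ⟨hx, hy, hxy⟩ := mem_boxBoundary.1 hb
    rw [mem_boxFinset_iff] at hx hy
    have hadj := openGraph_adj_unitVec.2 ho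
    by_cases hxA : x ∈ A
    · exact ⟨x, hA hxA, _, mem_boxCluster_of_adj (hA hxA) hadj hy, hadj, hxA,
        fun h => hxy ⟨fun _ => h, fun _ => hxA⟩, rfl⟩
    · have hyA : x + unitVec i ∈ A := by
        by_contra h; exact hxy ⟨fun h' => absurd h' hxA, fun h' => absurd h' h⟩
      exact ⟨_, hA hyA, x, mem_boxCluster_of_adj (hA hyA) hadj.symm hx, hadj.symm, hyA, hxA,
        Sym2.eq_swap⟩
  · refine ((Set.toFinite (boxCluster ω n ×ˢ boxCluster ω n)).image
      fun q => s(q.1, q.2)).subset ?_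
    rintro e ⟨x, hx, y, hy, -, -, -, rfl⟩
    exact ⟨(x, y), ⟨hx, hy⟩, rfl⟩

open Classical in
/-- A small cut of the cluster produces a long linked boundary with half of its edges closed. -/
theorem HasSmallCut.exists_boundary {d n : ℕ} (hd : 2 ≤ d) {r : ℝ} (hr : 0 < r)
    (hrn : 2 * r * (2 * n + 1) ≤ isoConst d) {ω : Config d} (h : HasSmallCut n r ω) :
    ∃ E : Finset (Fin d → ℤ), Linked Near (boxBoundary n E) ∧
      (boxBoundary n E).Nonempty ∧
      isoConst d * (1 / r) ^ (((d : ℝ) - 1) / d) ≤ (boxBoundary n E).card ∧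
      2 * ((boxBoundary n E).filter fun e => ω (bond e) = true).card ≤
        (boxBoundary n E).card := by
  obtain ⟨A, hne, hA, hcard, hcut⟩ := h
  have hd' : (2 : ℝ) ≤ d := by exact_mod_cast hd
  have hα : 0 ≤ ((d : ℝ) - 1) / d := div_nonneg (by linarith) (by linarith)
  set C : Finset (Fin d → ℤ) := (Set.toFinite (boxCluster ω n)).toFinset with hC
  have hmemC : ∀ x, x ∈ C ↔ x ∈ boxCluster ω n := fun x => by simp [hC]
  have hCB : C ⊆ boxFinset d n := fun x hx =>
    mem_boxFinset_iff.2 (boxCluster_subset_box ω n ((hmemC x).1 hx))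
  have hAC : A ⊆ C := fun x hx => (hmemC x).2 (hA hx)
  rw [Set.ncard_eq_toFinset_card _ (Set.toFinite _), ← hC] at hcard
  have hcs := Finset.card_sdiff_add_card_eq_card hAC
  have hApos := hne.card_pos
  have hB : Bottleneck n C (fun e => ω (bond e) = true) r A := by
    refine ⟨hAC.trans hCB, by rwa [Finset.inter_eq_left.2 hAC], Finset.card_pos.1 (by omega), ?_⟩
    rw [Finset.inter_eq_left.2 hAC, min_eq_left (by exact_mod_cast (by omega))]
    exact le_trans (by exact_mod_cast card_open_boxBoundary_le hA) hcut
  obtain ⟨E, ⟨hE, ⟨x, hx⟩, ⟨y, hy⟩, hle⟩, hl⟩ := hB.exists_linked hd hr.le hCB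
  rw [Finset.mem_inter] at hx
  rw [Finset.mem_sdiff] at hy
  set a : ℝ := min ((E ∩ C).card : ℝ) ((C \ E).card : ℝ) with ha
  set o := ((boxBoundary n E).filter fun e => ω (bond e) = true).card with ho
  obtain ⟨e, heb, heo⟩ := exists_open_boxBoundary ((hmemC x).1 hx.2) ((hmemC y).1 hy.1) hx.1 hy.2
  have ho1 : (1 : ℝ) ≤ o := by
    exact_mod_cast Finset.card_pos.2 ⟨e, Finset.mem_filter.2 ⟨heb, heo⟩⟩
  -- The open boundary edge just found gives `1 ≤ o ≤ r * a`: a sparse cut must separate large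
  -- parts.
  have hra : 1 / r ≤ a := by
    rw [div_le_iff₀ hr]; linarith
  have ha0 : 0 < a := lt_of_lt_of_le (by positivity) hra
  have haE : a ≤ E.card := (min_le_left _ _).trans
    (by exact_mod_cast Finset.card_le_card Finset.inter_subset_left)
  have haE' : a ≤ (boxFinset d n \ E).card := (min_le_right _ _).trans
    (by exact_mod_cast Finset.card_le_card (Finset.sdiff_subset_sdiff hCB le_rfl))
  have hiso := isoperimetry_min hd hE ha0.le haE haE'
  have hc := isoConst_pos hd
  refine ⟨E, hl, ⟨e, heb⟩, le_trans ?_ hiso, ?_⟩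
  · exact mul_le_mul_of_nonneg_left (Real.rpow_le_rpow (by positivity) hra hα) hc.le
  · have hN : (0 : ℝ) < 2 * n + 1 := by positivity
    have haN : a ≤ a ^ (((d : ℝ) - 1) / d) * (2 * n + 1) := by
      have h1 : a ^ (1 / (d : ℝ)) ≤ 2 * n + 1 := by
        have h2 : a ≤ (2 * n + 1 : ℝ) ^ (d : ℝ) := by
          refine haE.trans ?_
          have := Finset.card_le_card hE
          rw [card_boxFinset] at this
          rw [Real.rpow_natCast]
          exact_mod_cast this
        calc a ^ (1 / (d : ℝ)) ≤ ((2 * n + 1 : ℝ) ^ (d : ℝ)) ^ (1 / (d : ℝ)) :=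
              Real.rpow_le_rpow ha0.le h2 (by positivity)
          _ = 2 * n + 1 := by
              rw [← Real.rpow_mul hN.le, mul_one_div_cancel (by linarith), Real.rpow_one]
      calc a = a ^ (((d : ℝ) - 1) / d) * a ^ (1 / (d : ℝ)) := by
            rw [← Real.rpow_add ha0, ← add_div, sub_add_cancel, div_self (by linarith),
              Real.rpow_one]
        _ ≤ _ := mul_le_mul_of_nonneg_left h1 (Real.rpow_nonneg ha0.le _)
    have : (2 * o : ℝ) ≤ (boxBoundary n E).card := by
      refine le_trans ?_ hiso
      have hX := Real.rpow_nonneg ha0.le (((d : ℝ) - 1) / d)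
      calc (2 * o : ℝ) ≤ 2 * r * a := by linarith
        _ ≤ 2 * r * (a ^ (((d : ℝ) - 1) / d) * (2 * n + 1)) :=
            mul_le_mul_of_nonneg_left haN (by positivity)
        _ = 2 * r * (2 * n + 1) * a ^ (((d : ℝ) - 1) / d) := by ring
        _ ≤ _ := mul_le_mul_of_nonneg_right hrn hX
    exact_mod_cast this

/-! ### Choice of constants -/

theorem volume_le_exp {d n : ℕ} (hd : 2 ≤ d) (hn : 1 ≤ n) :
    2 * ((2 * n + 1 : ℝ) ^ d * d) ≤
      Real.exp ((2 * d * 3 ^ d + 2 * d) * (n : ℝ) ^ (((d : ℝ) - 1) / d)) := by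
  have hd' : (2 : ℝ) ≤ d := by exact_mod_cast hd
  have hn' : (1 : ℝ) ≤ n := by exact_mod_cast hn
  set y := (n : ℝ) ^ (((d : ℝ) - 1) / d) with hy
  -- For `d ≥ 2` the exponent is at least one half, so `y ≥ √n` and the polynomial volume is at most
  -- an exponential in `y`.
  have hα : 1 / 2 ≤ ((d : ℝ) - 1) / d := by
    rw [div_le_div_iff₀ (by norm_num) (by linarith)]; linarith
  have hsq : Real.sqrt n ≤ y := by
    rw [Real.sqrt_eq_rpow]
    exact Real.rpow_le_rpow_of_exponent_le hn' hα
  have hy1 : 1 ≤ y := Real.one_le_rpow hn' (by linarith)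
  have hexp : ∀ z : ℝ, z ≤ Real.exp z := fun z => by linarith [Real.add_one_le_exp z]
  have h1 : (n : ℝ) ≤ Real.exp (2 * y) := by
    calc (n : ℝ) = Real.sqrt n ^ 2 := (Real.sq_sqrt (by linarith)).symm
      _ ≤ Real.exp y ^ 2 := pow_le_pow_left₀ (Real.sqrt_nonneg _) (hsq.trans (hexp y)) 2
      _ = Real.exp (2 * y) := by rw [← Real.exp_nat_mul]; norm_num
  have h2 : (n : ℝ) ^ d ≤ Real.exp (2 * d * y) := by
    calc (n : ℝ) ^ d ≤ Real.exp (2 * y) ^ d := pow_le_pow_left₀ (by linarith) h1 d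
      _ = Real.exp (2 * d * y) := by rw [← Real.exp_nat_mul]; congr 1; ring
  have h3 : (2 * d * 3 ^ d : ℝ) ≤ Real.exp (2 * d * 3 ^ d * y) :=
    (le_mul_of_one_le_right (by positivity) hy1).trans (hexp _)
  calc 2 * ((2 * n + 1 : ℝ) ^ d * d) ≤ 2 * ((3 * n : ℝ) ^ d * d) := by
        have := pow_le_pow_left₀ (by positivity) (by linarith : (2 * n + 1 : ℝ) ≤ 3 * n) d
        have := mul_le_mul_of_nonneg_right this (by positivity : (0 : ℝ) ≤ d)
        linarith
    _ = (2 * d * 3 ^ d) * (n : ℝ) ^ d := by rw [mul_pow]; ring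
    _ ≤ Real.exp (2 * d * 3 ^ d * y) * Real.exp (2 * d * y) :=
        mul_le_mul h3 h2 (by positivity) (Real.exp_pos _).le
    _ = _ := by rw [← Real.exp_add]; congr 1; ring

/-- Small cuts of the cluster are unlikely. -/
theorem bondMeasure_hasSmallCut_le {d : ℕ} (hd : 2 ≤ d) :
    ∃ p₀ : I, p₀ < 1 ∧ ∃ ρ : ℝ, 0 < ρ ∧ ∀ p : I, p₀ < p → ∀ n : ℕ, 1 ≤ n →
      (bondMeasure d p).real {ω | HasSmallCut n (ρ / n) ω} ≤
        Real.exp (-1 * (n : ℝ) ^ (((d : ℝ) - 1) / d)) := by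
  have hd' : (2 : ℝ) ≤ d := by exact_mod_cast hd
  have hα : 0 < ((d : ℝ) - 1) / d := div_pos (by linarith) (by linarith)
  set α := ((d : ℝ) - 1) / d with hαdef
  have hc := isoConst_pos hd
  set c := isoConst d with hcdef
  set K : ℝ := (3 : ℝ) ^ d * d with hK
  have hK1 : 1 ≤ K := one_le_mul_of_one_le_of_one_le (one_le_pow₀ (by norm_num)) (by linarith)
  set R : ℝ := 2 * d * 3 ^ d + 2 * d with hR
  have hR0 : 0 < R := by positivity
  set q : ℝ := (1 / (12 * K ^ 2)) ^ 2 with hq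
  have hq0 : 0 < q := by positivity
  have hq1 : q ≤ 1 := by
    refine pow_le_one₀ (by positivity) ?_
    rw [div_le_one (by positivity)]
    have : 1 ≤ K ^ 2 := one_le_pow₀ hK1
    linarith
  -- The bound `q` on `1 - p` is what `peierls` needs. The bound `c / 6` on `ρ` leaves at most half
  -- of the boundary open; the other bound makes it at least `(R + 1) * n ^ α` long, where `R` pays
  -- for the volume and `1` remains as the rate.
  refine ⟨⟨1 - q, by constructor <;> linarith⟩, ?_, min (c / 6) ((c / (R + 1)) ^ (1 / α)),
    by positivity, ?_⟩
  · rw [← Subtype.coe_lt_coe]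
    change 1 - q < 1
    linarith
  intro p hp n hn
  set ρ := min (c / 6) ((c / (R + 1)) ^ (1 / α)) with hρ
  have hρ0 : 0 < ρ := by positivity
  have hn' : (1 : ℝ) ≤ n := by exact_mod_cast hn
  have hp' : 1 - q < (p : ℝ) := hp
  have hsqrt : 12 * K ^ 2 * Real.sqrt (1 - p) ≤ 1 := by
    have h1 : Real.sqrt (1 - p) ≤ 1 / (12 * K ^ 2) := by
      rw [Real.sqrt_le_left (by positivity)]
      linarith
    calc 12 * K ^ 2 * Real.sqrt (1 - p) ≤ 12 * K ^ 2 * (1 / (12 * K ^ 2)) :=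
          mul_le_mul_of_nonneg_left h1 (by positivity)
      _ = 1 := mul_one_div_cancel (by positivity)
  have hρc : ρ ≤ c / 6 := min_le_left _ _
  have hρα : ρ ^ α ≤ c / (R + 1) := by
    calc ρ ^ α ≤ ((c / (R + 1)) ^ (1 / α)) ^ α :=
          Real.rpow_le_rpow hρ0.le (min_le_right _ _) hα.le
      _ = c / (R + 1) := by
          rw [← Real.rpow_mul (by positivity), one_div_mul_cancel hα.ne', Real.rpow_one]
  have hrn : 2 * (ρ / n) * (2 * n + 1) ≤ c := by
    have h1 : 2 * (ρ / n) * (2 * n + 1) ≤ 2 * (ρ / n) * (3 * n) :=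
      mul_le_mul_of_nonneg_left (by linarith) (by positivity)
    have h2 : 2 * (ρ / n) * (3 * n) = 6 * ρ := by
      field_simp
      norm_num
    linarith
  have hlen : (R + 1) * (n : ℝ) ^ α ≤ c * (1 / (ρ / n)) ^ α := by
    rw [one_div_div, Real.div_rpow (by positivity) hρ0.le, ← mul_div_assoc,
      le_div_iff₀ (Real.rpow_pos_of_pos hρ0 _)]
    rw [le_div_iff₀ (by positivity)] at hρα
    have := mul_le_mul_of_nonneg_right hρα (Real.rpow_nonneg (by linarith : (0 : ℝ) ≤ n) α)
    linarith
  refine (measureReal_mono (fun ω (hω : HasSmallCut n (ρ / n) ω) =>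
    hω.exists_boundary hd (by positivity) hrn) (measure_ne_top _ _)).trans
    ((peierls hd hsqrt n _).trans ?_)
  calc _ ≤ Real.exp (R * (n : ℝ) ^ α) * Real.exp (-((R + 1) * (n : ℝ) ^ α)) :=
        mul_le_mul (volume_le_exp hd hn) (Real.exp_le_exp.2 (neg_le_neg hlen))
          (Real.exp_pos _).le (Real.exp_pos _).le
    _ = _ := by rw [← Real.exp_add]; congr 1; ring

end Percolation

theorem mainTheorem6 (d : ℕ) (hd : 2 ≤ d) :
    ∃ p₀ : unitInterval, p₀ < 1 ∧ ∃ β : ℝ, 0 < β ∧ ∃ ξ : ℝ, 0 < ξ ∧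
      ∀ p : unitInterval, p₀ < p → p < 1 → ∀ n : ℕ, 1 ≤ n →
        (Percolation.bondMeasure d p).real
            {ω | Percolation.cheegerConstant ω n ≤ ((β / (n : ℝ) : ℝ) : EReal)}
          ≤ Real.exp (-ξ * (n : ℝ) ^ (((d : ℝ) - 1) / (d : ℝ))) ∧
        (Percolation.bondMeasure d p).real
            {ω | Percolation.spectralGap ω n ≤ ((β / (n : ℝ) ^ 2 : ℝ) : EReal)}
          ≤ Real.exp (-ξ * (n : ℝ) ^ (((d : ℝ) - 1) / (d : ℝ))) := by
  obtain ⟨p₀, hp₀, ρ, hρ, hmain⟩ := Percolation.bondMeasure_hasSmallCut_le hd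
  have hd0 : (0 : ℝ) < d := by exact_mod_cast (by omega : 0 < d)
  -- The factor 2 to spare in each bound turns `≤ β` into a strict inequality; `4 * d` solves `8 * d
  -- ^ 2 * (2 * β) ≤ ρ ^ 2`.
  refine ⟨p₀, hp₀, min (ρ / 2) ((ρ / (4 * d)) ^ 2), by positivity, 1, one_pos, ?_⟩
  intro p hp _ n hn
  set β := min (ρ / 2) ((ρ / (4 * d)) ^ 2) with hβ
  have hβ0 : 0 < β := by positivity
  have hβ1 : β ≤ ρ / 2 := min_le_left _ _
  have hβ2 : β ≤ (ρ / (4 * d)) ^ 2 := min_le_right _ _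
  have hn0 : (0 : ℝ) < n := by exact_mod_cast hn
  constructor
  · refine (MeasureTheory.measureReal_mono (fun ω hω => ?_)
      (MeasureTheory.measure_ne_top _ _)).trans (hmain p hp n hn)
    refine Percolation.hasSmallCut_of_cheegerConstant_lt (lt_of_le_of_lt hω ?_)
    rw [EReal.coe_lt_coe_iff]
    exact div_lt_div_of_pos_right (by linarith) hn0
  · refine (MeasureTheory.measureReal_mono (fun ω hω => ?_)
      (MeasureTheory.measure_ne_top _ _)).trans (hmain p hp n hn)
    refine Percolation.hasSmallCut_of_spectralGap_lt hd (t := 2 * β / (n : ℝ) ^ 2)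
      (by positivity) ?_ (lt_of_le_of_lt hω ?_)
    · calc 8 * (d : ℝ) ^ 2 * (2 * β / (n : ℝ) ^ 2)
          ≤ 8 * (d : ℝ) ^ 2 * (2 * (ρ / (4 * d)) ^ 2 / (n : ℝ) ^ 2) := by gcongr
        _ = (ρ / n) ^ 2 := by field_simp; norm_num
    · rw [EReal.coe_lt_coe_iff]
      exact div_lt_div_of_pos_right (by linarith) (by positivity)
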